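/- **Setting.** There are $N$ independent students. For student $i$ let $Z_i^*\sim N(0,\Sigma)$ in $\mathbb R^p$, where $\Sigma$ is positive definite with unit diagonal, and let $Z_{ij}=F_j(Z^*_{ij})$. For a continuous predictor $F_j(t)=c_j+d_jt$ with $d_j>0$; for a binary or ordinal predictor with categories $0,\dots,K_j$, $F_j(t)=k$ if $t\in(c_{jk},c_{j,k+1}]$, where $-\infty=c_{j0}<c_{j1}<\dots<c_{jK_j}<c_{j,K_j+1}=\infty$. Given $Z_i$, the proficiency $\theta_i$ is $N(\beta_0+\sum_j\beta_j^\top g_j(Z_{ij}),\sigma^2)$ with $\sigma^2>0$, where $g_j$ is the identity for continuous and binary predictors and the vector of dummy variables $(\mathbb I(Z_{ij}\ge1),\dots,\mathbb I(Z_{ij}\ge K_j))$ for ordinal ones. Given $\theta_i$, the responses $Y_i=(Y_{il})_l$ to the items assigned to student $i$ are independent and follow two-parameter logistic or generalised partial credit models with known item parameters. Only $Z_i^{\rm obs}=(Z_{ij})_{j\in\mathcal A_i}$ is observed. The random set $\mathcal A_i$ is conditionally independent of $Y_i$ given $Z_i$, and $\mathbb P(\mathcal A_i=\alpha\mid Z_i=z)$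 depends only on $\alpha$ and $(z_j)_{j\in\alpha\cap\mathcal S^*}$, where $\mathcal S^*=\{j:\beta_j\ne0\}$. Predictors $j\notin\mathcal S^*$ are called null. Let $\mathbb P$ be this true model, and let $\mathbb Q$ be a (fixed) plug-in model of the same form with parameters $\hat\Sigma,\hat c,\hat d,\hat\beta_0,\hat\beta,\hat\sigma^2$ satisfying the same constraints. Let $S$ be a diagonal matrix such that $$G=\begin{pmatrix}\hat\Sigma&\hat\Sigma-S\\ \hat\Sigma-S&\hat\Sigma\end{pmatrix}$$ is positive definite. **Procedure.** For each run $m=1,\dots,M$, conditionally independently given the observed data, and for each $i$: sample $Z_i^*$ from its conditional law given $(Z_i^{\rm obs},Y_i)$ under $\mathbb Q$; sample $\tilde Z_i^*$ given $Z_i^*$ such that $(Z_i^*,\tilde Z_i^*)\sim N(0,G)$ (conditional law); the knockoffs are $\tilde Z^{(m)}_{ij}=\hat F_j(\tilde Z_{ij}^*)$, $j\in\mathcal A_i$. Let $W^{(m)}=w(Z^{\rm obs},\tilde Z^{{\rm obs},(m)},Y)\in\mathbb R^p$, where $w$ either has the flip-sign property (swapping, for all $j$ in a set $T$ and all $i$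 with $j\in\mathcal A_i$, the values $Z_{ij}$ and $\tilde Z_{ij}$ changes the sign of $w_j$ for $j\in T$ and leaves $w_j$ unchanged for $j\notin T$), or is the likelihood-based statistic $$w_j=\operatorname{sign}(\|\hat b_j^\dagger\|-\|\hat\gamma_j^\dagger\|)\max\{\|\hat b_j^\dagger\|,\|\hat\gamma_j^\dagger\|\}/\sqrt{p_j}.$$ Here $(\hat b,\hat\gamma)$ are the slopes of the predictors and of the knockoffs in the maximum likelihood estimate (with copula parameters fixed at those of $\mathbb Q$) of the latent regression of $\theta_i$ on all $g_j(Z_{ij})$ and $g_j(\tilde Z_{ij})$, $p_j$ is the dimension of $g_j$, and $\dagger$ denotes multiplication by $\operatorname{Cov}(g_j(Z_{ij}))^{1/2}$ (covariance under $\mathbb Q$); $w=0$ if there is no unique maximiser. For an integer $\nu\ge1$ put $$\tau^{(m)}=\inf\{t>0:1+|\{j:W^{(m)}_j<-t\}|=\nu\},$$ where, if this set is empty, the condition $=\nu$ is replaced by $\le\nu$. Let $\hat{\mathcal S}^{(m)}=\{j:W_j^{(m)}>\tau^{(m)}\}$, $\Pi_j=\frac1M\sum_m\mathbb I(j\in\hat{\mathcal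 S}^{(m)})$ and $\hat{\mathcal S}=\{j:\Pi_j\ge\eta\}$. **Observed divergence.** For a null $j$ and run $m$, let $$\widehat{\rm KL}{}_j^{(m)}=\sum_{i:\,j\in\mathcal A_i}\log\frac{\mathbb P_{ij}(Z_{ij}\mid Z^{\rm obs}_{i,-j},Y_i)\;\mathbb Q_{ij}(\tilde Z^{\rm obs}_{i,-j},\tilde Z_{ij}\mid Z^{\rm obs}_{i,-j},Z_{ij},Y_i)}{\mathbb P_{ij}(\tilde Z_{ij}\mid Z^{\rm obs}_{i,-j},Y_i)\;\mathbb Q_{ij}(\tilde Z^{\rm obs}_{i,-j},Z_{ij}\mid Z^{\rm obs}_{i,-j},\tilde Z_{ij},Y_i)},$$ with the knockoffs $\tilde Z$ of run $m$, where $\mathbb P_{ij}$ is the conditional density of $Z_{ij}$ given $(Z^{\rm obs}_{i,-j},Y_i)$ under $\mathbb P$ and $\mathbb Q_{ij}$ is the conditional density of the knockoffs $(\tilde Z^{\rm obs}_{i,-j},\tilde Z_{ij})$ given $(Z^{\rm obs}_{i,-j},Z_{ij},Y_i)$ under $\mathbb Q$. For $\epsilon\ge0$ let $$\Pi_j^\dagger=\frac1M\sum_{m=1}^M\mathbb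 I\bigl(j\in\hat{\mathcal S}^{(m)}\text{ and }\widehat{\rm KL}{}_j^{(m)}\le\epsilon\bigr).$$ **Theorem.** (1) If $\mathbb P(\Pi_j^\dagger\ge\eta)\le\mathbb E[\Pi_j^\dagger]$ for every $j\notin\mathcal S^*$, then $$\mathbb E\bigl|\{j\in\hat{\mathcal S}\setminus\mathcal S^*:\ \widehat{\rm KL}{}_j^{(m)}\le\epsilon\text{ for all }m=1,\dots,M\}\bigr|\le\nu e^{\epsilon}.$$ (2) Let $M=31$ and $\eta=1/2$. If, for a $j\notin\mathcal S^*$, the probability mass function of $\Pi_j^\dagger$ is non-increasing on $\{0,1/31,\dots,1\}$, then $\mathbb P(\Pi_j^\dagger\ge\eta)\le\mathbb E[\Pi_j^\dagger]$. -/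

import Mathlib

open MeasureTheory ProbabilityTheory
open scoped ENNReal NNReal

noncomputable section

namespace LatentKnockoff

/-! ### Study design: predictors, cognitive items, assignment of items to students -/

/-- A predictor is continuous, or takes the ordered categories `0, …, K`
(`K = 1`: binary, `K > 1`: ordinal). -/
inductive PredictorKind where
  | continuous : PredictorKind
  | categorical (K : ℕ) : PredictorKind

/-- The dimension of the slope of a predictor. -/
def PredictorKind.dim : PredictorKind → ℕ
  | .continuous => 1
  | .categorical K => K

/-- The `k`-th entry (`k = 0, …, dim - 1`) of the transformation `g_j`: the identity for a
continuous predictor, the dummy variables `𝕀(x ≥ 1), …, 𝕀(x ≥ K)` for a categorical one.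
For a binary predictor the only dummy variable is the predictor itself. -/
def PredictorKind.feature : PredictorKind → ℕ → ℝ → ℝ
  | .continuous, _, x => x
  | .categorical _, k, x => open Classical in if (k : ℝ) + 1 ≤ x then 1 else 0

/-- A cognitive item with categories `0, …, K` and known parameters `a`, `b 1, …, b K`. -/
structure Item where
  K : ℕ
  a : ℝ
  b : ℕ → ℝ

/-- Generalised partial credit model (for `K = 1`, the two-parameter logistic model):
the probability of the response `y` given the proficiency `θ`. -/
def Item.prob (it : Item) (y : ℕ) (θ : ℝ) : ℝ :=
  Real.exp (∑ r ∈ Finset.Icc 1 y, (it.a * θ + it.b r)) /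
    ∑ k ∈ Finset.range (it.K + 1), Real.exp (∑ r ∈ Finset.Icc 1 k, (it.a * θ + it.b r))

/-- `N` students, `p` predictors, `J` cognitive items; `assigned i` is the set of items
that student `i` is assigned. -/
structure Study (N p J : ℕ) where
  kind : Fin p → PredictorKind
  item : Fin J → Item
  assigned : Fin N → Finset (Fin J)

variable {N p J : ℕ}

/-- Possible cognitive response vectors of student `i`. -/
abbrev Study.Resp (s : Study N p J) (i : Fin N) : Type :=
  (l : {l : Fin J // l ∈ s.assigned i}) → Fin ((s.item l.1).K + 1)

/-- Observed data of student `i`: the set `A` of observed predictors, the values of the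
predictors (entries outside `A` are recorded as `0`), and the cognitive responses. -/
abbrev Study.Obs (s : Study N p J) (i : Fin N) : Type :=
  Finset (Fin p) × (Fin p → ℝ) × s.Resp i

/-- Observed data of student `i` together with a knockoff copy of the observed predictors. -/
abbrev Study.PairObs (s : Study N p J) (i : Fin N) : Type := s.Obs i × (Fin p → ℝ)

/-- Keep the entries with index in `A` and erase (set to `0`) the others. -/
def mask (A : Finset (Fin p)) (z : Fin p → ℝ) : Fin p → ℝ := fun j => if j ∈ A then z j else 0

/-! ### Latent regression model and Gaussian copula model -/

/-- Slopes: one vector for each predictor. -/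
abbrev Study.Slopes (s : Study N p J) : Type := (j : Fin p) → Fin (s.kind j).dim → ℝ

/-- `β_1ᵀ g_1(z_1) + ⋯ + β_pᵀ g_p(z_p)`. -/
def Study.linPred (s : Study N p J) (β : s.Slopes) (z : Fin p → ℝ) : ℝ :=
  ∑ j, ∑ k, β j k * (s.kind j).feature k (z j)

/-- The probability of the responses `y` of student `i` when the proficiency `θ` has the
distribution `N(m, v)` and the responses are independent given `θ`. -/
def Study.respProb (s : Study N p J) {i : Fin N} (y : s.Resp i) (m : ℝ) (v : ℝ≥0) : ℝ :=
  ∫ θ, ∏ l, (s.item l.1).prob (y l) θ ∂(gaussianReal m v)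

/-- Density of the centred multivariate normal distribution with covariance matrix `S`. -/
def gaussDensity {ι : Type} [Fintype ι] [DecidableEq ι] (S : Matrix ι ι ℝ) (x : ι → ℝ) : ℝ :=
  (Real.sqrt ((2 * Real.pi) ^ Fintype.card ι * S.det))⁻¹ *
    Real.exp (-(x ⬝ᵥ (S⁻¹.mulVec x)) / 2)

/-- Parameters of the Gaussian copula model: the correlation matrix of the underlying normal
variables, location `c_j` and scale `d_j` of the continuous predictors, and cut points
`c_{j1}, …, c_{jK}` of the categorical ones (other entries are not used). -/
structure Copula (p : ℕ) where
  corr : Matrix (Fin p) (Fin p) ℝ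
  loc : Fin p → ℝ
  scale : Fin p → ℝ
  cut : Fin p → ℕ → ℝ

/-- The constraints on the parameters of the Gaussian copula model. -/
structure Copula.Valid (c : Copula p) (s : Study N p J) : Prop where
  posDef : c.corr.PosDef
  diag : ∀ j, c.corr j j = 1
  scale_pos : ∀ j, s.kind j = .continuous → 0 < c.scale j
  cut_lt : ∀ j K, s.kind j = .categorical K →
    ∀ k l, 1 ≤ k → k < l → l ≤ K → c.cut j k < c.cut j l

/-- The transformation `F_j`: `c_j + d_j t` for a continuous predictor; for a categorical one,
the category `k` with `t ∈ (c_{jk}, c_{j,k+1}]`, that is, the number of cut points below `t`. -/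
def Copula.trans (c : Copula p) (s : Study N p J) (j : Fin p) (t : ℝ) : ℝ :=
  match s.kind j with
  | .continuous => c.loc j + c.scale j * t
  | .categorical K => open Classical in (((Finset.Icc 1 K).filter (fun k => c.cut j k < t)).card : ℝ)

/-- The vector of predictors determined by the vector of underlying variables. -/
def Copula.transVec (c : Copula p) (s : Study N p J) (t : Fin p → ℝ) : Fin p → ℝ :=
  fun j => c.trans s j (t j)

/-- Lebesgue measure of the underlying variable `t` along the fibre `F_j t = x`: for a
continuous predictor the point mass `d_j⁻¹` at `(x - c_j) / d_j`, for a categorical one Lebesgue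
measure on the interval of the category `x`. -/
def Copula.fibre (c : Copula p) (s : Study N p J) (j : Fin p) (x : ℝ) : Measure ℝ :=
  match s.kind j with
  | .continuous => ENNReal.ofReal (c.scale j)⁻¹ • Measure.dirac ((x - c.loc j) / c.scale j)
  | .categorical _ => volume.restrict {t | c.trans s j t = x}

/-- Lebesgue measure of the underlying vector along the observation `z_j`, `j ∈ A`: the
coordinates outside `A` are free. Integrating a density of the underlying vector against this
measure gives the density of the observed predictors (with respect to Lebesgue measure for
continuous and counting measure for categorical predictors). -/
def Copula.fibreVec (c : Copula p) (s : Study N p J) (A : Finset (Fin p)) (z : Fin p → ℝ) :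
    Measure (Fin p → ℝ) :=
  Measure.pi fun j => if j ∈ A then c.fibre s j (z j) else volume

/-- A joint model of predictors and responses: Gaussian copula parameters, and intercept,
slopes and residual variance of the structural model. -/
structure Model (s : Study N p J) where
  cop : Copula p
  intercept : ℝ
  slope : s.Slopes
  resVar : ℝ≥0

/-- Admissible parameters. -/
structure Model.Valid {s : Study N p J} (P : Model s) : Prop where
  cop : P.cop.Valid s
  resVar_pos : 0 < P.resVar

/-- The set of non-null predictors: those with a non-zero slope. -/
def Model.nonnull {s : Study N p J} (P : Model s) : Finset (Fin p) :=
  open Classical in Finset.univ.filter fun j => P.slope j ≠ 0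

/-- Conditional probability `f(y | z; β, σ²)` of the responses given the complete predictors. -/
def Model.resp {s : Study N p J} (P : Model s) {i : Fin N} (y : s.Resp i) (z : Fin p → ℝ) : ℝ :=
  s.respProb y (P.intercept + s.linPred P.slope z) P.resVar

/-- Joint density of the observed predictors `z_j`, `j ∈ A`, and the responses `y`. -/
def Model.obsDensity {s : Study N p J} (P : Model s) {i : Fin N} (A : Finset (Fin p))
    (z : Fin p → ℝ) (y : s.Resp i) : ℝ :=
  ∫ t, gaussDensity P.cop.corr t * P.resp y (P.cop.transVec s t) ∂(P.cop.fibreVec s A z)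

/-! ### Missing data -/

/-- `q i A z` is the conditional probability, given the complete predictors `z`, that `A` is
the set of observed predictors of student `i`. -/
structure IsMissingness (q : Fin N → Finset (Fin p) → (Fin p → ℝ) → ℝ) : Prop where
  nonneg : ∀ i A z, 0 ≤ q i A z
  sum_eq_one : ∀ i z, ∑ A, q i A z = 1
  measurable : ∀ i A, Measurable (q i A)

/-- The SMAR condition with respect to the set `T` of predictors: the probability of observing
the set `A` depends on the predictors in `A ∩ T` only. -/
def SMAR (q : Fin N → Finset (Fin p) → (Fin p → ℝ) → ℝ) (T : Finset (Fin p)) : Prop :=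
  ∀ i A z z', (∀ j ∈ A ∩ T, z j = z' j) → q i A z = q i A z'

/-- The law of the observed data of student `i` under the true model: the underlying vector `t`
is normal, the predictors are `F(t)`, and given the predictors, the responses `y` and the set `A`
of observed predictors are independent with probability mass functions `f(y | z)` and
`q(A | z)`. -/
def Model.obsLaw {s : Study N p J} (P : Model s)
    (q : Fin N → Finset (Fin p) → (Fin p → ℝ) → ℝ) (i : Fin N) : Measure (s.Obs i) :=
  (((volume : Measure (Fin p → ℝ)).prod
      ((Measure.count : Measure (s.Resp i)).prod
        (Measure.count : Measure (Finset (Fin p))))).withDensity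
    fun x => ENNReal.ofReal (gaussDensity P.cop.corr x.1 *
      P.resp x.2.1 (P.cop.transVec s x.1) * q i x.2.2 (P.cop.transVec s x.1))).map
    fun x => (x.2.2, mask x.2.2 (P.cop.transVec s x.1), x.2.1)

/-! ### Knockoff generation under a plug-in model -/

/-- The covariance matrix `G` of the underlying variables of predictors and knockoffs, for a
diagonal matrix with entries `S`. -/
def Copula.knockoffCov (c : Copula p) (S : Fin p → ℝ) : Matrix (Fin p ⊕ Fin p) (Fin p ⊕ Fin p) ℝ :=
  Matrix.fromBlocks c.corr (c.corr - Matrix.diagonal S) (c.corr - Matrix.diagonal S) c.corr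

/-- Step 1: the conditional law of the underlying variables given the observed predictors
and the responses. -/
def Model.posterior {s : Study N p J} (Q : Model s) {i : Fin N} (x : s.Obs i) :
    Measure (Fin p → ℝ) :=
  let m := (Q.cop.fibreVec s x.1 x.2.1).withDensity fun t =>
    ENNReal.ofReal (gaussDensity Q.cop.corr t * Q.resp x.2.2 (Q.cop.transVec s t))
  (m Set.univ)⁻¹ • m

/-- Step 2: the conditional law of the underlying variables of the knockoffs given those of
the predictors, when both together are normal with covariance matrix `G`. -/
def Copula.knockoffStep (c : Copula p) (S : Fin p → ℝ) (t : Fin p → ℝ) : Measure (Fin p → ℝ) :=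
  (volume : Measure (Fin p → ℝ)).withDensity fun t' =>
    ENNReal.ofReal (gaussDensity (c.knockoffCov S) (Sum.elim t t') / gaussDensity c.corr t)

/-- Steps 1 to 3: the law of the knockoff copy of the observed predictors of student `i`. -/
def Model.knockoffLaw {s : Study N p J} (Q : Model s) (S : Fin p → ℝ) {i : Fin N} (x : s.Obs i) :
    Measure (Fin p → ℝ) :=
  ((Q.posterior x).bind (Q.cop.knockoffStep S)).map fun t' => mask x.1 (Q.cop.transVec s t')

/-- The joint law of the observed data of all students and their knockoffs from `M` runs: the
students are independent; the observed data follow the true model `P`; given the data, the runs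
are independent and generate the knockoffs under the plug-in model `Q`. -/
def studyLaw {s : Study N p J} (P Q : Model s) (S : Fin p → ℝ)
    (q : Fin N → Finset (Fin p) → (Fin p → ℝ) → ℝ) (M : ℕ) :
    Measure ((i : Fin N) → s.Obs i × (Fin M → Fin p → ℝ)) :=
  Measure.pi fun i => (P.obsLaw q i).bind fun x =>
    (Measure.pi fun _ : Fin M => Q.knockoffLaw S x).map (Prod.mk x)

/-! ### Knockoff statistics -/

/-- Swap the predictors in `T` with their knockoffs, where they are observed. -/
def swapPair {s : Study N p J} (T : Finset (Fin p)) (d : (i : Fin N) → s.PairObs i) :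
    (i : Fin N) → s.PairObs i := fun i =>
  (((d i).1.1, fun j => if j ∈ T ∧ j ∈ (d i).1.1 then (d i).2 j else (d i).1.2.1 j, (d i).1.2.2),
    fun j => if j ∈ T ∧ j ∈ (d i).1.1 then (d i).1.2.1 j else (d i).2 j)

/-- The flip-sign property, which defines knockoff statistics. -/
def FlipSign {s : Study N p J} (w : ((i : Fin N) → s.PairObs i) → Fin p → ℝ) : Prop :=
  ∀ (T : Finset (Fin p)) (d : (i : Fin N) → s.PairObs i) (j : Fin p),
    w (swapPair T d) j = if j ∈ T then -w d j else w d j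

/-- Parameters of the structural model extended by the knockoff variables. -/
structure ExtParam (s : Study N p J) where
  intercept : ℝ
  β : s.Slopes
  γ : s.Slopes
  resVar : ℝ≥0

/-- Joint density of observed predictors `z_j`, knockoffs `z'_j`, `j ∈ A`, and responses `y`
in the extended latent regression model. -/
def Copula.extDensity (c : Copula p) (s : Study N p J) (S : Fin p → ℝ) (θ : ExtParam s)
    {i : Fin N} (A : Finset (Fin p)) (z z' : Fin p → ℝ) (y : s.Resp i) : ℝ :=
  ∫ u, gaussDensity (c.knockoffCov S) (Sum.elim u.1 u.2) *
      s.respProb y (θ.intercept + s.linPred θ.β (c.transVec s u.1) +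
        s.linPred θ.γ (c.transVec s u.2)) θ.resVar
    ∂((c.fibreVec s A z).prod (c.fibreVec s A z'))

/-- The log-likelihood of the extended latent regression model. -/
def Copula.extLogLik (c : Copula p) (s : Study N p J) (S : Fin p → ℝ)
    (d : (i : Fin N) → s.PairObs i) (θ : ExtParam s) : ℝ :=
  ∑ i, Real.log (c.extDensity s S θ (d i).1.1 (d i).1.2.1 (d i).2 (d i).1.2.2)

/-- `θ` is a maximum likelihood estimate. -/
def Copula.IsMLE (c : Copula p) (s : Study N p J) (S : Fin p → ℝ)
    (d : (i : Fin N) → s.PairObs i) (θ : ExtParam s) : Prop :=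
  0 < θ.resVar ∧ ∀ θ' : ExtParam s, 0 < θ'.resVar → c.extLogLik s S d θ' ≤ c.extLogLik s S d θ

/-- The covariance matrix of `g_j(Z_j)` in the Gaussian copula model. -/
def Copula.featureCov (c : Copula p) (s : Study N p J) (j : Fin p) :
    Matrix (Fin (s.kind j).dim) (Fin (s.kind j).dim) ℝ :=
  fun k l => cov[fun t => (s.kind j).feature k (c.trans s j t),
    fun t => (s.kind j).feature l (c.trans s j t); gaussianReal 0 1]

/-- The Euclidean norm of the standardised coefficient `Cov(g_j(Z_j))^{1/2} b`, that is, the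
square root of `bᵀ Cov(g_j(Z_j)) b`. -/
def Copula.stdNorm (c : Copula p) (s : Study N p J) (j : Fin p)
    (b : Fin (s.kind j).dim → ℝ) : ℝ :=
  Real.sqrt (b ⬝ᵥ ((c.featureCov s j).mulVec b))

/-- The likelihood-based knockoff statistics; they are set to `0` for data for which there
is no unique maximum likelihood estimate. -/
def Copula.likStat (c : Copula p) (s : Study N p J) (S : Fin p → ℝ)
    (d : (i : Fin N) → s.PairObs i) (j : Fin p) : ℝ :=
  open Classical in
  if h : ∃! θ : ExtParam s, c.IsMLE s S d θ then
    let nβ := c.stdNorm s j (h.choose.β j)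
    let nγ := c.stdNorm s j (h.choose.γ j)
    Real.sign (nβ - nγ) *
      max (nβ / Real.sqrt (s.kind j).dim) (nγ / Real.sqrt (s.kind j).dim)
  else 0

/-! ### Selection procedures -/

/-- `1 + |{j : W_j < -t}|`. -/
def negCount (W : Fin p → ℝ) (t : ℝ) : ℕ :=
  open Classical in 1 + (Finset.univ.filter fun j => W j < -t).card

/-- The threshold `τ = inf {t > 0 : 1 + |{j : W_j < -t}| = ν}`. When no `t` gives equality
(fewer than `ν - 1` negative statistics, or a jump over `ν` because of ties), the condition is
`1 + |{j : W_j < -t}| ≤ ν` instead; the two infima agree whenever the first set is non-empty. -/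
def threshold (ν : ℕ) (W : Fin p → ℝ) : ℝ :=
  open Classical in
  if {t : ℝ | 0 < t ∧ negCount W t = ν}.Nonempty then sInf {t : ℝ | 0 < t ∧ negCount W t = ν}
  else sInf {t : ℝ | 0 < t ∧ negCount W t ≤ ν}

/-- The baseline selection `{j : W_j > τ}`. -/
def baseline (ν : ℕ) (W : Fin p → ℝ) : Finset (Fin p) :=
  open Classical in Finset.univ.filter fun j => threshold ν W < W j

/-- The selection frequency of `j` in the selections `Sel m`, `m = 1, …, M`. -/
def frequency {M : ℕ} (Sel : Fin M → Finset (Fin p)) (j : Fin p) : ℝ :=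
  (∑ m, if j ∈ Sel m then (1 : ℝ) else 0) / M

/-- The derandomised selection: the predictors with selection frequency at least `η`. -/
def derandomised {M : ℕ} (η : ℝ) (Sel : Fin M → Finset (Fin p)) : Finset (Fin p) :=
  open Classical in Finset.univ.filter fun j => η ≤ frequency Sel j

/-! ### Observed Kullback-Leibler divergence -/

/-- Conditional density of predictor `j` at `x` given the other observed predictors and the
responses, for `j ∈ A`. -/
def Model.condDensity {s : Study N p J} (P : Model s) {i : Fin N} (A : Finset (Fin p)) (j : Fin p)
    (x : ℝ) (z : Fin p → ℝ) (y : s.Resp i) : ℝ :=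
  P.obsDensity A (Function.update z j x) y / P.obsDensity (A.erase j) z y

/-- Conditional density of the knockoff copy `z'` given the observed predictors `z` and the
responses. In the model, the responses do not depend on the knockoffs given the predictors. -/
def Model.knockoffDensity {s : Study N p J} (Q : Model s) (S : Fin p → ℝ) {i : Fin N}
    (A : Finset (Fin p)) (z' z : Fin p → ℝ) (y : s.Resp i) : ℝ :=
  Q.cop.extDensity s S ⟨Q.intercept, Q.slope, 0, Q.resVar⟩ A z z' y / Q.obsDensity A z y

/-- The observed Kullback-Leibler divergence of predictor `j` between the true model `P` and
the plug-in model `Q`. -/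
def KLhat {s : Study N p J} (P Q : Model s) (S : Fin p → ℝ) (j : Fin p)
    (d : (i : Fin N) → s.PairObs i) : ℝ :=
  ∑ i, if j ∈ (d i).1.1 then
    let A := (d i).1.1
    let z := (d i).1.2.1
    let y := (d i).1.2.2
    let z' := (d i).2
    Real.log
      ((P.condDensity A j (z j) z y * Q.knockoffDensity S A z' z y) /
        (P.condDensity A j (z' j) z y *
          Q.knockoffDensity S A (Function.update z' j (z j)) (Function.update z j (z' j)) y))
  else 0

/-! ### The derandomised procedure on random data -/

section Procedure

variable {Ω : Type*} {s : Study N p J} {M : ℕ}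

/-- The data of run `m`: observed data and the knockoffs of that run. -/
def runData (X : (i : Fin N) → Ω → s.Obs i) (Z : Fin M → Fin N → Ω → Fin p → ℝ)
    (m : Fin M) (ω : Ω) : (i : Fin N) → s.PairObs i := fun i => (X i ω, Z m i ω)

/-- The selections of all runs with the knockoff statistics `w`. -/
def runSel (w : ((i : Fin N) → s.PairObs i) → Fin p → ℝ) (ν : ℕ)
    (X : (i : Fin N) → Ω → s.Obs i) (Z : Fin M → Fin N → Ω → Fin p → ℝ) (ω : Ω) :
    Fin M → Finset (Fin p) := fun m => baseline ν (w (runData X Z m ω))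

/-- `Π_j^†`: the proportion of runs that select `j` with observed divergence at most `ε`. -/
def PiDagger (P Q : Model s) (S : Fin p → ℝ) (w : ((i : Fin N) → s.PairObs i) → Fin p → ℝ)
    (ν : ℕ) (ε : ℝ) (X : (i : Fin N) → Ω → s.Obs i) (Z : Fin M → Fin N → Ω → Fin p → ℝ)
    (j : Fin p) (ω : Ω) : ℝ :=
  open Classical in
  (∑ m, if j ∈ runSel w ν X Z ω m ∧ KLhat P Q S j (runData X Z m ω) ≤ ε then (1 : ℝ) else 0) / M

/-- The selected null predictors whose observed divergence is at most `ε` in all runs. -/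
def selectedNulls (P Q : Model s) (S : Fin p → ℝ)
    (w : ((i : Fin N) → s.PairObs i) → Fin p → ℝ) (ν : ℕ) (η ε : ℝ)
    (X : (i : Fin N) → Ω → s.Obs i) (Z : Fin M → Fin N → Ω → Fin p → ℝ) (ω : Ω) :
    Finset (Fin p) :=
  open Classical in
  (derandomised η (runSel w ν X Z ω) \ P.nonnull).filter fun j =>
    ∀ m, KLhat P Q S j (runData X Z m ω) ≤ ε

end Procedure

end LatentKnockoff

end

open LatentKnockoff

/-!
For a null predictor `j`, exchanging `Z_ij` and its knockoff for all students observing `j`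
changes the law of the data of a run by the density `exp KLhat_j`: given the other predictors and
the responses, the density of the pair is the product of the two conditional densities that enter
`KLhat_j`, and neither the missingness mechanism nor the responses depend on the value of `Z_ij`.
Hence `j` is selected with `KLhat_j ≤ ε` with probability at most `exp ε` times the probability
that `j` is selected from the exchanged data. By the flip-sign property the exchange only changes
the sign of `W_j`, and for every `W` at most `ν` indices are selected after changing their own
sign. Averaging over the runs and inserting the Markov-type hypothesis gives the bound. For a
non-increasing probability mass function, the reflection `k ↦ M - k` of the values `k / M` gives
the Markov-type inequality.
-/

noncomputable section

namespace LatentKnockoff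

/-! ### Finite product measures and kernels -/

section Pi

theorem lintegral_fin_prod_eq_prod {n : ℕ} {E : Fin n → Type*} {mE : ∀ i, MeasurableSpace (E i)}
    {μ : (i : Fin n) → Measure (E i)} [∀ i, SigmaFinite (μ i)]
    {f : (i : Fin n) → E i → ℝ≥0∞} (hf : ∀ i, Measurable (f i)) :
    ∫⁻ x, ∏ i, f i (x i) ∂(Measure.pi μ) = ∏ i, ∫⁻ x, f i x ∂(μ i) := by
  induction n with
  | zero => simp
  | succ n ih =>
    have hm : Measurable fun x : (i : Fin n) → E i.succ => ∏ i : Fin n, f i.succ (x i) :=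
      Finset.measurable_prod _ fun i _ => (hf i.succ).comp (measurable_pi_apply i)
    calc ∫⁻ x, ∏ i, f i (x i) ∂(Measure.pi μ)
        = ∫⁻ z, f 0 z.1 * ∏ i : Fin n, f i.succ (z.2 i)
            ∂((μ 0).prod (Measure.pi fun i : Fin n => μ i.succ)) := by
          simp only [Fin.prod_univ_succ]
          exact (measurePreserving_piFinSuccAbove μ 0).lintegral_comp_emb
            (MeasurableEquiv.measurableEmbedding _)
            fun z => f 0 z.1 * ∏ i : Fin n, f i.succ (z.2 i)
      _ = ∏ i, ∫⁻ x, f i x ∂(μ i) := by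
          rw [lintegral_prod_mul (hf 0).aemeasurable hm.aemeasurable, ih fun i => hf i.succ,
            Fin.prod_univ_succ]

variable {ι : Type*} [Fintype ι] {E : ι → Type*} {mE : ∀ i, MeasurableSpace (E i)}
  {μ : (i : ι) → Measure (E i)} [∀ i, SigmaFinite (μ i)] {f : (i : ι) → E i → ℝ≥0∞}

theorem lintegral_fintype_prod_eq_prod (hf : ∀ i, Measurable (f i)) :
    ∫⁻ x, ∏ i, f i (x i) ∂(Measure.pi μ) = ∏ i, ∫⁻ x, f i x ∂(μ i) := by
  let e := (Fintype.equivFin ι).symm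
  rw [← (measurePreserving_piCongrLeft _ e).lintegral_comp_emb
    (MeasurableEquiv.measurableEmbedding _)]
  simp_rw [← e.prod_comp, MeasurableEquiv.coe_piCongrLeft, Equiv.piCongrLeft_apply_apply]
  exact lintegral_fin_prod_eq_prod fun i => hf _

theorem pi_withDensity (hf : ∀ i, Measurable (f i))
    [∀ i, SigmaFinite ((μ i).withDensity (f i))] :
    Measure.pi (fun i => (μ i).withDensity (f i)) =
      (Measure.pi μ).withDensity fun x => ∏ i, f i (x i) := by
  refine Measure.pi_eq fun s hs => ?_
  rw [withDensity_apply _ (.univ_pi hs), Measure.restrict_pi_pi, lintegral_fintype_prod_eq_prod hf]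
  exact Finset.prod_congr rfl fun i _ => (withDensity_apply _ (hs i)).symm

end Pi

section PiKernel

variable {α : Type*} {mα : MeasurableSpace α} {n : ℕ}

theorem exists_kernel_apply_eq_pi {E : Fin n → Type*} {mE : ∀ i, MeasurableSpace (E i)}
    (κ : (i : Fin n) → Kernel α (E i)) [∀ i, IsSFiniteKernel (κ i)]
    [∀ i a, SigmaFinite (κ i a)] :
    ∃ K : Kernel α ((i : Fin n) → E i), IsSFiniteKernel K ∧
      ∀ a, K a = Measure.pi fun i => κ i a := by
  induction n with
  | zero =>
    exact ⟨Kernel.const α (Measure.pi fun i : Fin 0 => i.elim0), inferInstance, fun a => by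
      rw [Kernel.const_apply]
      congr 1
      exact funext fun i => i.elim0⟩
  | succ n ih =>
    obtain ⟨K, hK, hKa⟩ := ih fun i => κ ((0 : Fin (n + 1)).succAbove i)
    refine ⟨(κ 0 ×ₖ K).map (MeasurableEquiv.piFinSuccAbove E 0).symm, inferInstance, fun a => ?_⟩
    rw [Kernel.map_apply _ (MeasurableEquiv.measurable _), Kernel.prod_apply, hKa]
    exact ((measurePreserving_piFinSuccAbove (fun i => κ i a) 0).symm).map_eq

/-- The kernel of products of finitely many kernels, for which Mathlib has only the binary
version `×ₖ`. The measures `κ i a` have to be σ-finite because `Measure.pi` is only well behaved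
for such measures. -/
def piKernel {E : Fin n → Type*} [∀ i, MeasurableSpace (E i)]
    (κ : (i : Fin n) → Kernel α (E i)) [∀ i, IsSFiniteKernel (κ i)]
    [∀ i a, SigmaFinite (κ i a)] : Kernel α ((i : Fin n) → E i) :=
  (exists_kernel_apply_eq_pi κ).choose

section

variable {E : Fin n → Type*} {mE : ∀ i, MeasurableSpace (E i)}
  (κ : (i : Fin n) → Kernel α (E i)) [∀ i, IsSFiniteKernel (κ i)] [∀ i a, SigmaFinite (κ i a)]

instance : IsSFiniteKernel (piKernel κ) :=
  (exists_kernel_apply_eq_pi κ).choose_spec.1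

@[simp]
theorem piKernel_apply (a : α) : piKernel κ a = Measure.pi fun i => κ i a :=
  (exists_kernel_apply_eq_pi κ).choose_spec.2 a

end

instance {β E : Type*} {mβ : MeasurableSpace β} {mE : MeasurableSpace E} (κ : Kernel α E)
    [∀ a, SigmaFinite (κ a)] {g : β → α} (hg : Measurable g) (b : β) :
    SigmaFinite (κ.comap g hg b) := by
  rw [Kernel.comap_apply]
  infer_instance

theorem pi_compProd {A E : Type*} {mA : MeasurableSpace A} {mE : MeasurableSpace E}
    (μ : Fin n → Measure A) [∀ i, SigmaFinite (μ i)] (κ : Fin n → Kernel A E)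
    [∀ i, IsSFiniteKernel (κ i)] [∀ i a, SigmaFinite (κ i a)]
    [∀ i, SigmaFinite (μ i ⊗ₘ κ i)] :
    (Measure.pi fun i => μ i ⊗ₘ κ i).map (MeasurableEquiv.arrowProdEquivProdArrow A E (Fin n)) =
      Measure.pi μ ⊗ₘ piKernel fun i => (κ i).comap _ (measurable_pi_apply i) := by
  let e := MeasurableEquiv.arrowProdEquivProdArrow A E (Fin n)
  have hsymm : Measure.pi (fun i => μ i ⊗ₘ κ i) =
      (Measure.pi μ ⊗ₘ piKernel fun i => (κ i).comap _ (measurable_pi_apply i)).map e.symm := by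
    refine Measure.pi_eq fun B hB => ?_
    have hpre (x : Fin n → A) : Prod.mk x ⁻¹' (e.symm ⁻¹' Set.univ.pi B) =
        Set.univ.pi fun i => Prod.mk (x i) ⁻¹' B i := rfl
    rw [e.symm.map_apply, Measure.compProd_apply (e.symm.measurable (.univ_pi hB))]
    simp only [hpre, piKernel_apply, Measure.pi_pi, Kernel.comap_apply,
      Measure.compProd_apply (hB _)]
    exact lintegral_fintype_prod_eq_prod fun i =>
      Kernel.measurable_kernel_prodMk_left (hB i)
  rw [hsymm, Measure.map_map e.measurable e.symm.measurable, e.self_comp_symm, Measure.map_id]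

end PiKernel

/-! ### Exchanging coordinates of two vectors -/

section SwapCoord

variable {ι E : Type*} [DecidableEq ι]

/-- Exchange the coordinates in `T` of two vectors: the transformation of a predictor vector and
its knockoff copy on which the exchangeability argument rests. -/
def swapCoord (T : Finset ι) (u : (ι → E) × (ι → E)) : (ι → E) × (ι → E) :=
  (T.piecewise u.2 u.1, T.piecewise u.1 u.2)

@[simp]
theorem swapCoord_swapCoord (T : Finset ι) (u : (ι → E) × (ι → E)) :
    swapCoord T (swapCoord T u) = u := by
  simp [swapCoord, Finset.piecewise_same]

theorem swapCoord_singleton (j : ι) (x y : ι → E) :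
    swapCoord {j} (x, y) = (Function.update x j (y j), Function.update y j (x j)) := by
  simp only [swapCoord, Finset.piecewise_singleton]

variable [MeasurableSpace E]

theorem measurable_swapCoord (T : Finset ι) : Measurable (swapCoord (E := E) T) :=
  (measurable_pi_lambda _ fun j => by unfold Finset.piecewise; split_ifs <;> fun_prop).prodMk
    (measurable_pi_lambda _ fun j => by unfold Finset.piecewise; split_ifs <;> fun_prop)

theorem measurePreserving_swapCoord [Fintype ι] (T : Finset ι) (μ ν : ι → Measure E)
    [∀ i, SigmaFinite (μ i)] [∀ i, SigmaFinite (ν i)] :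
    MeasurePreserving (swapCoord T) ((Measure.pi μ).prod (Measure.pi ν))
      ((Measure.pi (T.piecewise ν μ)).prod (Measure.pi (T.piecewise μ ν))) := by
  have hl (j : ι) : SigmaFinite (T.piecewise ν μ j) := by
    unfold Finset.piecewise; split_ifs <;> infer_instance
  have hr (j : ι) : SigmaFinite (T.piecewise μ ν j) := by
    unfold Finset.piecewise; split_ifs <;> infer_instance
  have hcoord (j : ι) :
      MeasurePreserving (if j ∈ T then Prod.swap else id : E × E → E × E)
        ((μ j).prod (ν j)) ((T.piecewise ν μ j).prod (T.piecewise μ ν j)) := by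
    by_cases hj : j ∈ T
    · simpa only [hj, if_true, Finset.piecewise_eq_of_mem] using Measure.measurePreserving_swap
    · simpa only [hj, if_false, Finset.piecewise_eq_of_notMem _ _ _ hj] using .id _
  have h := ((measurePreserving_arrowProdEquivProdArrow E E ι _ _).comp
    (measurePreserving_pi _ _ hcoord)).comp
      (measurePreserving_arrowProdEquivProdArrow E E ι μ ν).symm
  convert h using 1
  ext u j <;> by_cases hj : j ∈ T <;>
    simp [swapCoord, MeasurableEquiv.arrowProdEquivProdArrow, Equiv.arrowProdEquivProdArrow, hj]

end SwapCoord

/-! ### The multivariate normal density -/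

section Gaussian

open scoped Matrix

variable {ι κ : Type} [Fintype ι] [DecidableEq ι] [Fintype κ] [DecidableEq κ]

theorem measurable_gaussDensity (S : Matrix ι ι ℝ) : Measurable (gaussDensity S) := by
  have hquad : Continuous fun x : ι → ℝ => x ⬝ᵥ S⁻¹ *ᵥ x :=
    continuous_id.dotProduct (continuous_const.matrix_mulVec continuous_id)
  have hcont : Continuous (gaussDensity S) :=
    continuous_const.mul (Real.continuous_exp.comp (hquad.neg.div_const 2))
  exact hcont.measurable

theorem gaussDensity_pos {S : Matrix ι ι ℝ} (hS : S.PosDef) (x : ι → ℝ) :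
    0 < gaussDensity S x := by
  have hdet := hS.det_pos
  unfold gaussDensity
  positivity

theorem gaussDensity_comp_equiv {S : Matrix ι ι ℝ} (e : ι ≃ ι) (he : S.submatrix e e = S)
    (x : ι → ℝ) : gaussDensity S (x ∘ e) = gaussDensity S x := by
  have hinv : S⁻¹ = S⁻¹.submatrix e e := by
    conv_lhs => rw [← he, Matrix.inv_submatrix_equiv]
  have hquad : (x ∘ e) ⬝ᵥ S⁻¹ *ᵥ (x ∘ e) = x ⬝ᵥ S⁻¹ *ᵥ x := by
    conv_lhs => rw [hinv]
    rw [Matrix.submatrix_mulVec_equiv, Function.comp_assoc, e.self_comp_symm, Function.comp_id,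
      comp_equiv_dotProduct_comp_equiv]
  rw [gaussDensity, gaussDensity, hquad]

open scoped MatrixOrder Matrix.Norms.L2Operator in
theorem exists_inv_eq_transpose_mul_self {S : Matrix ι ι ℝ} (hS : S.PosDef) :
    ∃ C : Matrix ι ι ℝ, C.det ≠ 0 ∧ S⁻¹ = Cᵀ * C := by
  obtain ⟨C, hC⟩ := CStarAlgebra.nonneg_iff_eq_star_mul_self.mp hS.inv.posSemidef.nonneg
  refine ⟨C, fun hdet => ?_, by simpa [Matrix.star_eq_conjTranspose] using hC⟩
  have hpos := hS.inv.det_pos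
  rw [hC, Matrix.det_mul, hdet, mul_zero] at hpos
  exact hpos.false

section InvEqTransposeMulSelf

variable {S C : Matrix ι ι ℝ}

theorem dotProduct_inv_mulVec (h : S⁻¹ = Cᵀ * C) (x : ι → ℝ) :
    x ⬝ᵥ S⁻¹ *ᵥ x = ∑ j, (C *ᵥ x) j ^ 2 := by
  rw [h, ← Matrix.mulVec_mulVec, Matrix.dotProduct_mulVec, Matrix.vecMul_transpose, dotProduct]
  simp_rw [sq]

theorem sqrt_two_pi_pow_mul_det (hS : S.PosDef) (h : S⁻¹ = Cᵀ * C) :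
    √((2 * Real.pi) ^ Fintype.card ι * S.det) =
      √(2 * Real.pi) ^ Fintype.card ι * |C.det|⁻¹ := by
  have hdet : S.det = (|C.det|⁻¹) ^ 2 := by
    have hmul := Matrix.det_nonsing_inv_mul_det S hS.det_pos.ne'.isUnit
    rw [h, Matrix.det_mul, Matrix.det_transpose, ← sq, ← sq_abs] at hmul
    rw [inv_pow]
    exact eq_inv_of_mul_eq_one_right hmul
  rw [hdet, Real.sqrt_eq_iff_mul_self_eq (by positivity) (by positivity), mul_mul_mul_comm,
    ← mul_pow, Real.mul_self_sqrt (by positivity), ← sq]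

theorem gaussDensity_eq_prod (hS : S.PosDef) (h : S⁻¹ = Cᵀ * C) (x : ι → ℝ) :
    gaussDensity S x = |C.det| * ∏ j, gaussianPDFReal 0 1 ((C *ᵥ x) j) := by
  simp only [gaussDensity, gaussianPDFReal, dotProduct_inv_mulVec h, sqrt_two_pi_pow_mul_det hS h]
  rw [Finset.prod_mul_distrib, ← Real.exp_sum, Finset.prod_const, Finset.card_univ]
  simp only [NNReal.coe_one, mul_one, sub_zero, mul_inv, inv_inv, inv_pow, neg_div,
    Finset.sum_neg_distrib, Finset.sum_div]
  ring

end InvEqTransposeMulSelf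

theorem lintegral_gaussDensity {S : Matrix ι ι ℝ} (hS : S.PosDef) :
    ∫⁻ x, ENNReal.ofReal (gaussDensity S x) = 1 := by
  obtain ⟨C, hC, hSC⟩ := exists_inv_eq_transpose_mul_self hS
  have hφ : Measurable fun x : ι → ℝ => ∏ j, gaussianPDF 0 1 (x j) :=
    Finset.measurable_prod _ fun j _ =>
      (measurable_gaussianPDF 0 1).comp (measurable_pi_apply j)
  have hlin : Measurable (Matrix.toLin' C) :=
    (LinearMap.continuous_of_finiteDimensional (Matrix.toLin' C)).measurable
  calc ∫⁻ x, ENNReal.ofReal (gaussDensity S x)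
      = ∫⁻ x, ENNReal.ofReal |C.det| * ∏ j, gaussianPDF 0 1 (Matrix.toLin' C x j) := by
        refine lintegral_congr fun x => ?_
        rw [gaussDensity_eq_prod hS hSC, ENNReal.ofReal_mul (abs_nonneg _),
          ENNReal.ofReal_prod_of_nonneg fun _ _ => gaussianPDFReal_nonneg _ _ _]
        rfl
    _ = ENNReal.ofReal |C.det| * (ENNReal.ofReal |C.det⁻¹| *
          ∫⁻ x : ι → ℝ, ∏ j, gaussianPDF 0 1 (x j)) := by
        rw [lintegral_const_mul' _ _ ENNReal.ofReal_ne_top, ← lintegral_map hφ hlin,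
          Real.map_matrix_volume_pi_eq_smul_volume_pi hC, lintegral_smul_measure, smul_eq_mul]
    _ = 1 := by
        rw [volume_pi, lintegral_fintype_prod_eq_prod fun _ => measurable_gaussianPDF 0 1]
        simp only [lintegral_gaussianPDF_eq_one 0 one_ne_zero, Finset.prod_const_one, mul_one]
        rw [← ENNReal.ofReal_mul (abs_nonneg _), ← abs_mul, mul_inv_cancel₀ hC, abs_one,
          ENNReal.ofReal_one]

theorem exists_sum_sq_le_mul_sum_sq_mulVec {C : Matrix ι ι ℝ} (hC : C.det ≠ 0) :
    ∃ D > 0, ∀ x : ι → ℝ, ∑ j, x j ^ 2 ≤ D * ∑ k, (C *ᵥ x) k ^ 2 := by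
  refine ⟨∑ j, ∑ k, C⁻¹ j k ^ 2 + 1, by positivity, fun x => ?_⟩
  have hx (j : ι) : x j = ∑ k, C⁻¹ j k * (C *ᵥ x) k := by
    conv_lhs => rw [← Matrix.one_mulVec x, ← Matrix.nonsing_inv_mul _ hC.isUnit,
      ← Matrix.mulVec_mulVec]
    rfl
  calc ∑ j, x j ^ 2
      ≤ ∑ j, (∑ k, C⁻¹ j k ^ 2) * ∑ k, (C *ᵥ x) k ^ 2 := by
        refine Finset.sum_le_sum fun j _ => ?_
        conv_lhs => rw [hx j]
        exact Finset.sum_mul_sq_le_sq_mul_sq _ _ _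
    _ ≤ (∑ j, ∑ k, C⁻¹ j k ^ 2 + 1) * ∑ k, (C *ᵥ x) k ^ 2 := by
        rw [← Finset.sum_mul]
        gcongr
        exact le_add_of_nonneg_right zero_le_one

theorem exists_gaussDensity_le {S : Matrix ι ι ℝ} (hS : S.PosDef) :
    ∃ K c : ℝ, 0 < c ∧ ∀ x, gaussDensity S x ≤ K * ∏ j, Real.exp (-c * x j ^ 2) := by
  obtain ⟨C, hC, hSC⟩ := exists_inv_eq_transpose_mul_self hS
  obtain ⟨D, hD, hle⟩ := exists_sum_sq_le_mul_sum_sq_mulVec hC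
  refine ⟨(√((2 * Real.pi) ^ Fintype.card ι * S.det))⁻¹, (2 * D)⁻¹, by positivity, fun x => ?_⟩
  rw [← Real.exp_sum, gaussDensity, dotProduct_inv_mulVec hSC]
  refine mul_le_mul_of_nonneg_left (Real.exp_le_exp.2 ?_) (by positivity)
  have hx : D⁻¹ * ∑ j, x j ^ 2 ≤ ∑ k, (C *ᵥ x) k ^ 2 := (inv_mul_le_iff₀ hD).2 (hle x)
  rw [← Finset.mul_sum, mul_inv]
  linarith

theorem posDef_schur {ι κ : Type*} [Fintype ι] [DecidableEq ι] [Finite κ]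
    {A : Matrix ι ι ℝ} {B : Matrix ι κ ℝ} {D : Matrix κ κ ℝ}
    (hG : (Matrix.fromBlocks A B Bᵀ D).PosDef) (hA : A.PosDef) :
    (D - Bᵀ * A⁻¹ * B).PosDef := by
  classical
  let _ := Fintype.ofFinite κ
  let _ : Invertible A := hA.isUnit.invertible
  have hsemi : (D - Bᵀ * A⁻¹ * B).PosSemidef := by
    simpa using (Matrix.PosDef.fromBlocks₁₁ B D hA).1 (by simpa using hG.posSemidef)
  refine hsemi.posDef_iff_det_ne_zero.2 fun hdet => ?_
  have hpos := hG.det_pos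
  rw [Matrix.det_fromBlocks₁₁, Matrix.invOf_eq_nonsing_inv, hdet, mul_zero] at hpos
  exact hpos.false

section FromBlocks

variable {A : Matrix ι ι ℝ} {B : Matrix ι κ ℝ} {D : Matrix κ κ ℝ}

theorem inv_fromBlocks_mulVec (hG : IsUnit (Matrix.fromBlocks A B Bᵀ D).det) (hA : IsUnit A.det)
    {t : ι → ℝ} {t' w : κ → ℝ}
    (hw : (D - Bᵀ * A⁻¹ * B) *ᵥ w = t' - Bᵀ *ᵥ A⁻¹ *ᵥ t) :
    (Matrix.fromBlocks A B Bᵀ D)⁻¹ *ᵥ Sum.elim t t' =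
      Sum.elim (A⁻¹ *ᵥ t - A⁻¹ *ᵥ B *ᵥ w) w := by
  have hmul : Matrix.fromBlocks A B Bᵀ D *ᵥ Sum.elim (A⁻¹ *ᵥ t - A⁻¹ *ᵥ B *ᵥ w) w =
      Sum.elim t t' := by
    rw [Matrix.fromBlocks_mulVec, Sum.elim_comp_inl, Sum.elim_comp_inr]
    congr 1
    · simp [Matrix.mulVec_sub, Matrix.mulVec_mulVec, Matrix.mul_nonsing_inv_cancel_left _ _ hA,
        Matrix.mul_nonsing_inv _ hA]
    · rw [sub_eq_iff_eq_add.1 hw.symm, Matrix.sub_mulVec, Matrix.mulVec_sub]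
      simp only [Matrix.mulVec_mulVec, Matrix.mul_assoc]
      abel
  rw [← hmul, Matrix.mulVec_mulVec, Matrix.nonsing_inv_mul _ hG, Matrix.one_mulVec]

theorem dotProduct_inv_fromBlocks_mulVec (hG : (Matrix.fromBlocks A B Bᵀ D).PosDef)
    (hA : A.PosDef) (t : ι → ℝ) (t' : κ → ℝ) :
    Sum.elim t t' ⬝ᵥ (Matrix.fromBlocks A B Bᵀ D)⁻¹ *ᵥ Sum.elim t t' =
      t ⬝ᵥ A⁻¹ *ᵥ t + (t' - Bᵀ *ᵥ A⁻¹ *ᵥ t) ⬝ᵥ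
        (D - Bᵀ * A⁻¹ * B)⁻¹ *ᵥ (t' - Bᵀ *ᵥ A⁻¹ *ᵥ t) := by
  set w := (D - Bᵀ * A⁻¹ * B)⁻¹ *ᵥ (t' - Bᵀ *ᵥ A⁻¹ *ᵥ t)
  have hw : (D - Bᵀ * A⁻¹ * B) *ᵥ w = t' - Bᵀ *ᵥ A⁻¹ *ᵥ t := by
    rw [Matrix.mulVec_mulVec, Matrix.mul_nonsing_inv _ (posDef_schur hG hA).det_pos.ne'.isUnit,
      Matrix.one_mulVec]
  have hAt : A⁻¹ᵀ = A⁻¹ := by simpa using hA.inv.isHermitian.eq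
  have hcross : t ⬝ᵥ A⁻¹ *ᵥ B *ᵥ w = (Bᵀ *ᵥ A⁻¹ *ᵥ t) ⬝ᵥ w := by
    rw [Matrix.dotProduct_mulVec, Matrix.dotProduct_mulVec, Matrix.mulVec_transpose,
      ← Matrix.mulVec_transpose A⁻¹, hAt]
  rw [inv_fromBlocks_mulVec hG.det_pos.ne'.isUnit hA.det_pos.ne'.isUnit hw,
    sumElim_dotProduct_sumElim, dotProduct_sub, hcross, sub_dotProduct]
  ring

theorem gaussDensity_fromBlocks (hG : (Matrix.fromBlocks A B Bᵀ D).PosDef) (hA : A.PosDef)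
    (t : ι → ℝ) (t' : κ → ℝ) :
    gaussDensity (Matrix.fromBlocks A B Bᵀ D) (Sum.elim t t') =
      gaussDensity A t * gaussDensity (D - Bᵀ * A⁻¹ * B) (t' - Bᵀ *ᵥ A⁻¹ *ᵥ t) := by
  let _ : Invertible A := hA.isUnit.invertible
  have hdet : (Matrix.fromBlocks A B Bᵀ D).det = A.det * (D - Bᵀ * A⁻¹ * B).det := by
    rw [Matrix.det_fromBlocks₁₁, Matrix.invOf_eq_nonsing_inv]
  have hAdet := hA.det_pos.le
  rw [gaussDensity, gaussDensity, gaussDensity, dotProduct_inv_fromBlocks_mulVec hG hA, hdet,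
    Fintype.card_sum, pow_add, mul_mul_mul_comm, Real.sqrt_mul (by positivity), mul_inv, neg_add,
    add_div, Real.exp_add]
  ring

theorem lintegral_gaussDensity_fromBlocks (hG : (Matrix.fromBlocks A B Bᵀ D).PosDef)
    (hA : A.PosDef) (t : ι → ℝ) :
    ∫⁻ t', ENNReal.ofReal
      (gaussDensity (Matrix.fromBlocks A B Bᵀ D) (Sum.elim t t') / gaussDensity A t) = 1 := by
  simp_rw [gaussDensity_fromBlocks hG hA, mul_div_cancel_left₀ _ (gaussDensity_pos hA t).ne']
  rw [lintegral_sub_right_eq_self (μ := volume)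
    (fun x => ENNReal.ofReal (gaussDensity (D - Bᵀ * A⁻¹ * B) x)) (Bᵀ *ᵥ A⁻¹ *ᵥ t)]
  exact lintegral_gaussDensity (posDef_schur hG hA)

end FromBlocks

end Gaussian

/-! ### Fibres of the Gaussian copula model -/

section Fibre

variable {N p J : ℕ}

/-- The reference measure for the values of a predictor: Lebesgue measure for a continuous
predictor, counting measure on the categories for a categorical one. -/
def PredictorKind.base : PredictorKind → Measure ℝ
  | .continuous => volume
  | .categorical K => Measure.sum fun k : Fin (K + 1) => Measure.dirac (k : ℝ)

instance (k : PredictorKind) : SigmaFinite k.base := by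
  cases k <;> unfold PredictorKind.base <;> infer_instance

/-- The reference measure for coordinate `j` of the data; unobserved predictors are recorded
as `0`. -/
def Study.baseAt (s : Study N p J) (A : Finset (Fin p)) (j : Fin p) : Measure ℝ :=
  if j ∈ A then (s.kind j).base else Measure.dirac 0

instance (s : Study N p J) (A : Finset (Fin p)) (j : Fin p) : SigmaFinite (s.baseAt A j) := by
  unfold Study.baseAt; split_ifs <;> infer_instance

/-- The reference measure for the observed predictors `z_j`, `j ∈ A`, with respect to which
`Model.obsDensity` is a density. -/
def Study.obsBase (s : Study N p J) (A : Finset (Fin p)) : Measure (Fin p → ℝ) :=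
  Measure.pi (s.baseAt A)

instance (s : Study N p J) (A : Finset (Fin p)) : SigmaFinite (s.obsBase A) := by
  unfold Study.obsBase; infer_instance

/-- The possible values of the observed predictors `z_j`, `j ∈ A`. Off this set the fibres are
null and the conditional densities are quotients by `0`. -/
def Study.support (s : Study N p J) (A : Finset (Fin p)) : Set (Fin p → ℝ) :=
  {z | ∀ j ∈ A, ∀ K, s.kind j = .categorical K → ∃ k ≤ K, z j = (k : ℕ)}

theorem Study.ae_mem_support (s : Study N p J) (A : Finset (Fin p)) :
    ∀ᵐ z ∂(s.obsBase A), z ∈ s.support A := by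
  have h (j : Fin p) : ∀ᵐ x : ℝ ∂(s.baseAt A j),
      j ∈ A → ∀ K, s.kind j = .categorical K → ∃ k ≤ K, x = (k : ℕ) := by
    by_cases hj : j ∈ A
    · cases hk : s.kind j with
      | continuous => simp
      | categorical K =>
        simp only [Study.baseAt, hj, if_true, hk, PredictorKind.base]
        rw [Measure.ae_sum_iff]
        intro k
        rw [ae_dirac_eq, Filter.eventually_pure]
        rintro - K' ⟨⟩
        exact ⟨k, Nat.lt_succ_iff.1 k.2, rfl⟩
    · simp [hj]
  exact ae_all_iff.2 fun j => (Measure.quasiMeasurePreserving_eval (s.baseAt A) j).ae (h j)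

theorem Study.mem_support_erase {s : Study N p J} {A : Finset (Fin p)} {z : Fin p → ℝ}
    (hz : z ∈ s.support A) (j : Fin p) : z ∈ s.support (A.erase j) :=
  fun k hk => hz k (Finset.mem_of_mem_erase hk)

theorem Study.swapCoord_mem_support {s : Study N p J} {A : Finset (Fin p)}
    {u : (Fin p → ℝ) × (Fin p → ℝ)} (h₁ : u.1 ∈ s.support A) (h₂ : u.2 ∈ s.support A)
    (T : Finset (Fin p)) :
    (swapCoord T u).1 ∈ s.support A ∧ (swapCoord T u).2 ∈ s.support A := by
  refine ⟨fun j hj K hK => ?_, fun j hj K hK => ?_⟩ <;>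
    simp only [swapCoord, Finset.piecewise] <;> split_ifs
  exacts [h₂ j hj K hK, h₁ j hj K hK, h₁ j hj K hK, h₂ j hj K hK]

variable (c : Copula p) (s : Study N p J)

theorem Copula.measurable_trans (j : Fin p) : Measurable (c.trans s j) := by
  unfold Copula.trans
  cases s.kind j with
  | continuous => fun_prop
  | categorical K =>
    simp only [Finset.card_filter, Nat.cast_sum, Nat.cast_ite, Nat.cast_one, Nat.cast_zero]
    exact Finset.measurable_sum _ fun k _ =>
      Measurable.ite measurableSet_Ioi measurable_const measurable_const

theorem Copula.measurable_transVec : Measurable (c.transVec s) :=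
  measurable_pi_lambda _ fun j => (c.measurable_trans s j).comp (measurable_pi_apply j)

theorem measurable_mask (A : Finset (Fin p)) : Measurable (mask A) := by
  refine measurable_pi_lambda _ fun j => ?_
  unfold mask
  split_ifs <;> fun_prop

theorem Copula.exists_fin_eq_trans {s : Study N p J} {j : Fin p} {K : ℕ}
    (hk : s.kind j = .categorical K) (t : ℝ) : ∃ k : Fin (K + 1), c.trans s j t = (k : ℕ) := by
  have hle : ((Finset.Icc 1 K).filter fun k => c.cut j k < t).card ≤ K :=
    (Finset.card_filter_le _ _).trans (by simp)
  exact ⟨⟨_, Nat.lt_succ_of_le hle⟩, by simp only [Copula.trans, hk]⟩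

theorem Copula.mask_transVec_mem_support (A : Finset (Fin p)) (t : Fin p → ℝ) :
    mask A (c.transVec s t) ∈ s.support A := by
  intro j hj K hK
  obtain ⟨k, hk⟩ := c.exists_fin_eq_trans hK (t j)
  exact ⟨k, Nat.lt_succ_iff.1 k.2, by simpa only [mask, hj, if_true, transVec] using hk⟩

/-- The recorded value of predictor `j` as a function of its underlying variable, that is,
a coordinate of `mask A ∘ c.transVec s`. -/
def Copula.maskTrans (A : Finset (Fin p)) (j : Fin p) (t : ℝ) : ℝ :=
  if j ∈ A then c.trans s j t else 0

theorem Copula.measurable_maskTrans (A : Finset (Fin p)) (j : Fin p) :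
    Measurable (c.maskTrans s A j) := by
  unfold Copula.maskTrans
  split_ifs
  exacts [c.measurable_trans s j, measurable_const]

theorem Copula.measurable_maskTrans_prodMk (A : Finset (Fin p)) (j : Fin p) :
    Measurable fun t => (c.maskTrans s A j t, t) :=
  (c.measurable_maskTrans s A j).prodMk measurable_id

/-- The fibre of the recorded value of predictor `j`: a coordinate of `Copula.fibreVec`. -/
def Copula.fibreAt (A : Finset (Fin p)) (j : Fin p) (x : ℝ) : Measure ℝ :=
  if j ∈ A then c.fibre s j x else volume

theorem Copula.fibreVec_eq_pi (A : Finset (Fin p)) (z : Fin p → ℝ) :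
    c.fibreVec s A z = Measure.pi fun j => c.fibreAt s A j (z j) := rfl

instance (j : Fin p) (x : ℝ) : SigmaFinite (c.fibre s j x) := by
  unfold Copula.fibre
  split
  · have := Measure.smul_finite (Measure.dirac ((x - c.loc j) / c.scale j))
      (c := ENNReal.ofReal (c.scale j)⁻¹) ENNReal.ofReal_ne_top
    infer_instance
  · infer_instance

instance (A : Finset (Fin p)) (j : Fin p) (x : ℝ) : SigmaFinite (c.fibreAt s A j x) := by
  unfold Copula.fibreAt; split_ifs <;> infer_instance

instance (A : Finset (Fin p)) (z : Fin p → ℝ) : SigmaFinite (c.fibreVec s A z) := by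
  rw [Copula.fibreVec_eq_pi]; infer_instance

theorem Copula.exists_kernel_apply_eq_fibre (j : Fin p) :
    ∃ κ : Kernel ℝ ℝ, IsSFiniteKernel κ ∧ ∀ x, κ x = c.fibre s j x := by
  cases hk : s.kind j with
  | continuous =>
    refine ⟨(Kernel.deterministic (fun x => (x - c.loc j) / c.scale j) (by fun_prop)).withDensity
      fun _ _ => ENNReal.ofReal (c.scale j)⁻¹,
      Kernel.IsSFiniteKernel.withDensity _ fun _ _ => ENNReal.ofReal_ne_top, fun x => ?_⟩
    rw [Kernel.withDensity_apply _ measurable_const, Kernel.deterministic_apply, withDensity_const]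
    simp only [Copula.fibre, hk]
  | categorical K =>
    have hcell (x : ℝ) : MeasurableSet {t | c.trans s j t = x} :=
      c.measurable_trans s j (measurableSet_singleton x)
    have hgraph : MeasurableSet {x : ℝ × ℝ | c.trans s j x.2 = x.1} :=
      measurableSet_eq_fun ((c.measurable_trans s j).comp measurable_snd) measurable_fst
    refine ⟨(Kernel.const ℝ volume).withDensity fun x t =>
      {x : ℝ × ℝ | c.trans s j x.2 = x.1}.indicator 1 (x, t),
      Kernel.IsSFiniteKernel.withDensity _ fun x t => ?_, fun x => ?_⟩
    · exact ne_top_of_le_ne_top ENNReal.one_ne_top (Set.indicator_le_self _ _ _)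
    · rw [Kernel.withDensity_apply _ (by exact measurable_one.indicator hgraph),
        Kernel.const_apply,
        Copula.fibre]
      simp only [hk]
      exact withDensity_indicator_one (hcell x)

theorem Copula.exists_kernel_apply_eq_fibreAt (A : Finset (Fin p)) (j : Fin p) :
    ∃ κ : Kernel ℝ ℝ, IsSFiniteKernel κ ∧ ∀ x, κ x = c.fibreAt s A j x := by
  unfold Copula.fibreAt
  split_ifs
  · exact c.exists_kernel_apply_eq_fibre s j
  · exact ⟨Kernel.const ℝ volume, inferInstance, Kernel.const_apply volume⟩

/-- `Copula.fibreAt` as a kernel. -/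
def Copula.fibreAtKernel (A : Finset (Fin p)) (j : Fin p) : Kernel ℝ ℝ :=
  (c.exists_kernel_apply_eq_fibreAt s A j).choose

instance (A : Finset (Fin p)) (j : Fin p) : IsSFiniteKernel (c.fibreAtKernel s A j) :=
  (c.exists_kernel_apply_eq_fibreAt s A j).choose_spec.1

theorem Copula.fibreAtKernel_apply (A : Finset (Fin p)) (j : Fin p) (x : ℝ) :
    c.fibreAtKernel s A j x = c.fibreAt s A j x :=
  (c.exists_kernel_apply_eq_fibreAt s A j).choose_spec.2 x

instance (A : Finset (Fin p)) (j : Fin p) (x : ℝ) : SigmaFinite (c.fibreAtKernel s A j x) := by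
  rw [Copula.fibreAtKernel_apply]; infer_instance

/-- `Copula.fibreVec` as a kernel. -/
def Copula.fibreKernel (A : Finset (Fin p)) : Kernel (Fin p → ℝ) (Fin p → ℝ) :=
  piKernel fun j => (c.fibreAtKernel s A j).comap _ (measurable_pi_apply j)

instance (A : Finset (Fin p)) : IsSFiniteKernel (c.fibreKernel s A) := by
  unfold Copula.fibreKernel; infer_instance

@[simp]
theorem Copula.fibreKernel_apply (A : Finset (Fin p)) (z : Fin p → ℝ) :
    c.fibreKernel s A z = c.fibreVec s A z := by
  simp only [Copula.fibreKernel, piKernel_apply, Kernel.comap_apply, Copula.fibreAtKernel_apply,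
    Copula.fibreVec_eq_pi]

theorem map_volume_add_mul {d : ℝ} (hd : 0 < d) (a : ℝ) :
    (volume : Measure ℝ).map (fun t => a + d * t) = ENNReal.ofReal d⁻¹ • volume := by
  calc (volume : Measure ℝ).map (fun t => a + d * t)
      = ((volume : Measure ℝ).map (d * ·)).map (a + ·) :=
        (Measure.map_map (measurable_const_add a) (measurable_const_mul d)).symm
    _ = ENNReal.ofReal d⁻¹ • volume := by
        rw [Real.map_volume_mul_left hd.ne', abs_of_pos (inv_pos.2 hd), Measure.map_smul,
          map_add_left_eq_self]

variable {c s}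

theorem Copula.Valid.lintegral_fibre_of_continuous (hc : c.Valid s) {j : Fin p}
    (hk : s.kind j = .continuous) {B : Set (ℝ × ℝ)} (hB : MeasurableSet B) :
    ∫⁻ x, c.fibre s j x (Prod.mk x ⁻¹' B) = volume ((fun t => (c.trans s j t, t)) ⁻¹' B) := by
  have hd := hc.scale_pos j hk
  let f (x : ℝ) : ℝ≥0∞ := B.indicator 1 (x, (x - c.loc j) / c.scale j)
  have hf : Measurable f := (measurable_one.indicator hB).comp (by fun_prop)
  calc ∫⁻ x, c.fibre s j x (Prod.mk x ⁻¹' B)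
      = ∫⁻ x, ENNReal.ofReal (c.scale j)⁻¹ * f x := lintegral_congr fun x => by
        simp only [Copula.fibre, hk, Measure.smul_apply, smul_eq_mul,
          Measure.dirac_apply' _ (measurable_prodMk_left hB)]
        rfl
    _ = ∫⁻ t, f (c.loc j + c.scale j * t) := by
        rw [lintegral_const_mul _ hf, ← smul_eq_mul, ← lintegral_smul_measure,
          ← map_volume_add_mul hd (c.loc j), lintegral_map hf (by fun_prop)]
    _ = ∫⁻ t, ((fun t => (c.trans s j t, t)) ⁻¹' B).indicator 1 t := lintegral_congr fun t => by
        have : (c.loc j + c.scale j * t - c.loc j) / c.scale j = t := by field_simp; ring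
        simp only [f, this, Copula.trans, hk]
        rfl
    _ = volume ((fun t => (c.trans s j t, t)) ⁻¹' B) :=
        lintegral_indicator_one (((c.measurable_trans s j).prodMk measurable_id) hB)

theorem Copula.lintegral_fibre_of_categorical {j : Fin p} {K : ℕ}
    (hk : s.kind j = .categorical K) {B : Set (ℝ × ℝ)} (hB : MeasurableSet B) :
    ∑ k : Fin (K + 1), c.fibre s j k (Prod.mk (k : ℝ) ⁻¹' B) =
      volume ((fun t => (c.trans s j t, t)) ⁻¹' B) := by
  let cell (k : Fin (K + 1)) : Set ℝ := 
    Prod.mk (k : ℝ) ⁻¹' B ∩ {t | c.trans s j t = (k : ℕ)}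
  have hcell (k : Fin (K + 1)) : MeasurableSet (cell k) :=
    (measurable_prodMk_left hB).inter (c.measurable_trans s j (measurableSet_singleton _))
  have hdisj : Pairwise (Function.onFun Disjoint cell) := fun k l hkl =>
    Set.disjoint_left.2 fun t h₁ h₂ => hkl (Fin.ext (by exact_mod_cast h₁.2.symm.trans h₂.2))
  have hunion : (fun t => (c.trans s j t, t)) ⁻¹' B = ⋃ k, cell k := by
    ext t
    obtain ⟨k, ht⟩ := c.exists_fin_eq_trans hk t
    simp only [Set.mem_preimage, Set.mem_iUnion]
    exact ⟨fun h => ⟨k, ht ▸ h, ht⟩, fun ⟨l, hl, htl⟩ => by rwa [htl]⟩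
  rw [hunion, measure_iUnion hdisj hcell, tsum_fintype]
  refine Finset.sum_congr rfl fun k _ => ?_
  simp only [cell, Copula.fibre, hk, Measure.restrict_apply (measurable_prodMk_left hB)]

theorem Copula.Valid.compProd_fibreAtKernel (hc : c.Valid s) (A : Finset (Fin p)) (j : Fin p) :
    s.baseAt A j ⊗ₘ c.fibreAtKernel s A j = volume.map fun t => (c.maskTrans s A j t, t) := by
  ext B hB
  rw [Measure.compProd_apply hB,
    Measure.map_apply (c.measurable_maskTrans_prodMk s A j) hB]
  simp only [Copula.fibreAtKernel_apply]
  by_cases hj : j ∈ A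
  · simp only [Copula.fibreAt, Study.baseAt, Copula.maskTrans, hj, if_true]
    cases hk : s.kind j with
    | continuous => exact hc.lintegral_fibre_of_continuous hk hB
    | categorical K =>
      simp only [PredictorKind.base, lintegral_sum_measure, lintegral_dirac, tsum_fintype]
      exact Copula.lintegral_fibre_of_categorical hk hB
  · simp [Copula.fibreAt, Study.baseAt, Copula.maskTrans, hj]

theorem Copula.Valid.compProd_fibreKernel (hc : c.Valid s) (A : Finset (Fin p)) :
    s.obsBase A ⊗ₘ c.fibreKernel s A = volume.map fun t => (mask A (c.transVec s t), t) := by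
  have hm (j : Fin p) := c.measurable_maskTrans_prodMk s A j
  have hσ (j : Fin p) : SigmaFinite ((volume : Measure ℝ).map fun t => (c.maskTrans s A j t, t)) :=
    .of_map _ measurable_snd.aemeasurable <| by
      rw [Measure.map_map measurable_snd (hm j)]
      exact (Measure.map_id (μ := (volume : Measure ℝ))).symm ▸ inferInstance
  have (j : Fin p) : SigmaFinite (s.baseAt A j ⊗ₘ c.fibreAtKernel s A j) :=
    hc.compProd_fibreAtKernel A j ▸ hσ j
  rw [Study.obsBase, Copula.fibreKernel, ← pi_compProd (s.baseAt A) (c.fibreAtKernel s A)]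
  simp_rw [hc.compProd_fibreAtKernel]
  rw [← Measure.pi_map_pi fun j => (hm j).aemeasurable, Measure.map_map
    (MeasurableEquiv.measurable _)
    (by exact measurable_pi_lambda _ fun j => (hm j).comp (measurable_pi_apply j))]
  rfl

theorem Copula.Valid.lintegral_fibreVec (hc : c.Valid s) (A : Finset (Fin p))
    {φ : (Fin p → ℝ) × (Fin p → ℝ) → ℝ≥0∞} (hφ : Measurable φ) :
    ∫⁻ z, ∫⁻ t, φ (z, t) ∂(c.fibreVec s A z) ∂(s.obsBase A) =
      ∫⁻ t, φ (mask A (c.transVec s t), t) := by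
  have hm : Measurable fun t => (mask A (c.transVec s t), t) :=
    ((measurable_mask A).comp (c.measurable_transVec s)).prodMk measurable_id
  simp_rw [← Copula.fibreKernel_apply]
  rw [← Measure.lintegral_compProd hφ, hc.compProd_fibreKernel, lintegral_map hφ hm]

theorem Copula.trans_eq_natCast {j : Fin p} {K k : ℕ} (hK : s.kind j = .categorical K)
    (hkK : k ≤ K) {t : ℝ} (hlt : ∀ m ∈ Finset.Icc 1 k, c.cut j m < t)
    (hgt : ∀ l ∈ Finset.Icc (k + 1) K, t < c.cut j l) : c.trans s j t = k := by
  have hfilter : (Finset.Icc 1 K).filter (fun m => c.cut j m < t) = Finset.Icc 1 k := by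
    ext m
    simp only [Finset.mem_Icc] at hlt hgt
    simp only [Finset.mem_filter, Finset.mem_Icc]
    refine ⟨fun ⟨hm, h⟩ => ⟨hm.1, ?_⟩, fun hm => ⟨⟨hm.1, hm.2.trans hkK⟩, hlt m hm⟩⟩
    by_contra! hkm
    exact (hgt m ⟨hkm, hm.2⟩).not_gt h
  simp [Copula.trans, hK, hfilter]

theorem Copula.Valid.volume_trans_eq_pos (hc : c.Valid s) {j : Fin p} {K k : ℕ}
    (hK : s.kind j = .categorical K) (hkK : k ≤ K) : 0 < volume {t | c.trans s j t = k} := by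
  let U : Set ℝ := (⋂ m ∈ Finset.Icc 1 k, Set.Ioi (c.cut j m)) ∩
    ⋂ l ∈ Finset.Icc (k + 1) K, Set.Iio (c.cut j l)
  have mem_U {t : ℝ} : t ∈ U ↔ (∀ m ∈ Finset.Icc 1 k, c.cut j m < t) ∧
      ∀ l ∈ Finset.Icc (k + 1) K, t < c.cut j l := by
    simp only [U, Set.mem_inter_iff, Set.mem_iInter, Set.mem_Ioi, Set.mem_Iio]
  have hopen : IsOpen U := (isOpen_biInter_finset fun _ _ => isOpen_Ioi).inter
    (isOpen_biInter_finset fun _ _ => isOpen_Iio)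
  have hne : U.Nonempty := by
    have hlt : ∀ a ∈ (Finset.Icc 1 k).image (c.cut j),
        ∀ b ∈ (Finset.Icc (k + 1) K).image (c.cut j), a < b := by
      simp only [Finset.forall_mem_image, Finset.mem_Icc]
      exact fun m hm l hl => hc.cut_lt j K hK m l hm.1 (by lia) hl.2
    obtain ⟨t, h₁, h₂⟩ := Order.exists_between_finsets _ _ hlt
    exact ⟨t, mem_U.2 ⟨fun m hm => h₁ _ (Finset.mem_image_of_mem _ hm),
      fun l hl => h₂ _ (Finset.mem_image_of_mem _ hl)⟩⟩
  refine (hopen.measure_pos volume hne).trans_le (measure_mono fun t ht => ?_)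
  exact Copula.trans_eq_natCast hK hkK (mem_U.1 ht).1 (mem_U.1 ht).2

theorem Copula.Valid.fibreAt_ne_zero (hc : c.Valid s) {A : Finset (Fin p)} {j : Fin p} {x : ℝ}
    (hx : j ∈ A → ∀ K, s.kind j = .categorical K → ∃ k ≤ K, x = (k : ℕ)) :
    c.fibreAt s A j x ≠ 0 := by
  unfold Copula.fibreAt
  split_ifs with hj
  · unfold Copula.fibre
    cases hk : s.kind j with
    | continuous =>
      rw [← Measure.measure_univ_ne_zero]
      simpa using hc.scale_pos j hk
    | categorical K =>
      obtain ⟨k, hkK, rfl⟩ := hx hj K hk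
      rw [Ne, Measure.restrict_eq_zero]
      exact (hc.volume_trans_eq_pos hk hkK).ne'
  · exact NeZero.ne _

theorem Copula.Valid.fibreVec_ne_zero (hc : c.Valid s) {A : Finset (Fin p)} {z : Fin p → ℝ}
    (hz : z ∈ s.support A) : c.fibreVec s A z ≠ 0 := by
  rw [Copula.fibreVec_eq_pi, ← Measure.measure_univ_ne_zero, Measure.pi_univ,
    Finset.prod_ne_zero_iff]
  exact fun j _ => Measure.measure_univ_ne_zero.2 (hc.fibreAt_ne_zero (hz j))

theorem Copula.integrable_exp_fibreAt {b : ℝ} (hb : 0 < b) (A : Finset (Fin p)) (j : Fin p)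
    (x : ℝ) : Integrable (fun t => Real.exp (-b * t ^ 2)) (c.fibreAt s A j x) := by
  have hvol := integrable_exp_neg_mul_sq hb
  unfold Copula.fibreAt Copula.fibre
  split_ifs
  · cases s.kind j with
    | continuous => exact (integrable_dirac (by simp)).smul_measure ENNReal.ofReal_ne_top
    | categorical K => exact hvol.restrict
  · exact hvol

theorem Copula.integrable_prod_exp_fibreVec {b : ℝ} (hb : 0 < b) (A : Finset (Fin p))
    (z : Fin p → ℝ) :
    Integrable (fun t : Fin p → ℝ => ∏ j, Real.exp (-b * t j ^ 2)) (c.fibreVec s A z) :=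
  Integrable.fintype_prod fun j => Copula.integrable_exp_fibreAt hb A j (z j)

theorem Copula.integrable_fibreVec {S : Matrix (Fin p) (Fin p) ℝ} (hS : S.PosDef)
    {f : (Fin p → ℝ) → ℝ} (hf : Measurable f) (h₀ : ∀ t, 0 ≤ f t) (h₁ : ∀ t, f t ≤ 1)
    (A : Finset (Fin p)) (z : Fin p → ℝ) :
    Integrable (fun t => gaussDensity S t * f t) (c.fibreVec s A z) := by
  obtain ⟨K, b, hb, hK⟩ := exists_gaussDensity_le hS
  refine ((Copula.integrable_prod_exp_fibreVec hb A z).const_mul K).mono'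
    ((measurable_gaussDensity S).mul hf).aestronglyMeasurable (ae_of_all _ fun t => ?_)
  have hg := (gaussDensity_pos hS t).le
  rw [Real.norm_of_nonneg (mul_nonneg hg (h₀ t))]
  exact (mul_le_of_le_one_right hg (h₁ t)).trans (hK t)

theorem measurable_sumElim {ι κ E : Type*} [MeasurableSpace E] :
    Measurable fun u : (ι → E) × (κ → E) => Sum.elim u.1 u.2 :=
  measurable_pi_lambda _ fun j => by
    cases j <;> simp only [Sum.elim_inl, Sum.elim_inr] <;> fun_prop

theorem Copula.integrable_fibreVec_prod {G : Matrix (Fin p ⊕ Fin p) (Fin p ⊕ Fin p) ℝ}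
    (hG : G.PosDef) {f : (Fin p → ℝ) × (Fin p → ℝ) → ℝ} (hf : Measurable f) (h₀ : ∀ t, 0 ≤ f t)
    (h₁ : ∀ t, f t ≤ 1) (A : Finset (Fin p)) (z z' : Fin p → ℝ) :
    Integrable (fun u => gaussDensity G (Sum.elim u.1 u.2) * f u)
      ((c.fibreVec s A z).prod (c.fibreVec s A z')) := by
  obtain ⟨K, b, hb, hK⟩ := exists_gaussDensity_le hG
  have hbound := ((Copula.integrable_prod_exp_fibreVec (c := c) (s := s) hb A z).mul_prod
    (Copula.integrable_prod_exp_fibreVec (c := c) (s := s) hb A z')).const_mul K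
  refine hbound.mono' (((measurable_gaussDensity G).comp measurable_sumElim).mul
    hf).aestronglyMeasurable (ae_of_all _ fun u => ?_)
  have hg := (gaussDensity_pos hG (Sum.elim u.1 u.2)).le
  rw [Real.norm_of_nonneg (mul_nonneg hg (h₀ u))]
  refine (mul_le_of_le_one_right hg (h₁ u)).trans ((hK _).trans_eq ?_)
  rw [Fintype.prod_sum_type]
  simp only [Sum.elim_inl, Sum.elim_inr]

end Fibre

/-! ### Response probabilities -/

theorem integral_pos_of_forall_pos {α : Type*} {mα : MeasurableSpace α} {μ : Measure α}
    {f : α → ℝ} (hμ : μ ≠ 0) (hf : ∀ x, 0 < f x) (hint : Integrable f μ) :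
    0 < ∫ x, f x ∂μ := by
  refine (integral_pos_iff_support_of_nonneg (fun x => (hf x).le) hint).2 ?_
  rw [Set.eq_univ_of_forall (s := Function.support f) fun x => (hf x).ne']
  exact Measure.measure_univ_pos.2 hμ

section Response

variable {N p J : ℕ} {s : Study N p J} {i : Fin N}

theorem Item.prob_pos (it : Item) (y : ℕ) (θ : ℝ) : 0 < it.prob y θ :=
  div_pos (Real.exp_pos _) (Finset.sum_pos (fun _ _ => Real.exp_pos _) (by simp))

theorem Item.prob_le_one (it : Item) {y : ℕ} (hy : y ≤ it.K) (θ : ℝ) : it.prob y θ ≤ 1 := by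
  refine div_le_one_of_le₀ ?_ (Finset.sum_nonneg fun _ _ => (Real.exp_pos _).le)
  exact Finset.single_le_sum
    (f := fun k => Real.exp (∑ r ∈ Finset.Icc 1 k, (it.a * θ + it.b r)))
    (fun _ _ => (Real.exp_pos _).le) (Finset.mem_range.2 (by lia))

theorem Item.measurable_prob (it : Item) (y : ℕ) : Measurable (it.prob y) := by
  unfold Item.prob
  fun_prop

theorem Study.prod_prob_pos (y : s.Resp i) (θ : ℝ) : 0 < ∏ l, (s.item l.1).prob (y l) θ :=
  Finset.prod_pos fun _ _ => Item.prob_pos _ _ _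

theorem Study.prod_prob_le_one (y : s.Resp i) (θ : ℝ) :
    ∏ l, (s.item l.1).prob (y l) θ ≤ 1 :=
  Finset.prod_le_one (fun _ _ => (Item.prob_pos _ _ _).le) fun l _ =>
    Item.prob_le_one _ (Nat.lt_succ_iff.1 (y l).2) _

theorem Study.measurable_prod_prob (y : s.Resp i) :
    Measurable fun θ => ∏ l, (s.item l.1).prob (y l) θ :=
  Finset.measurable_prod _ fun _ _ => Item.measurable_prob _ _

theorem Study.integrable_prod_prob (y : s.Resp i) (m : ℝ) (v : ℝ≥0) :
    Integrable (fun θ => ∏ l, (s.item l.1).prob (y l) θ) (gaussianReal m v) :=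
  .of_bound (s.measurable_prod_prob y).aestronglyMeasurable 1 <| ae_of_all _ fun θ => by
    rw [Real.norm_of_nonneg (s.prod_prob_pos y θ).le]
    exact s.prod_prob_le_one y θ

theorem Study.respProb_pos (y : s.Resp i) (m : ℝ) (v : ℝ≥0) : 0 < s.respProb y m v :=
  integral_pos_of_forall_pos (NeZero.ne _) (s.prod_prob_pos y) (s.integrable_prod_prob y m v)

theorem Study.respProb_le_one (y : s.Resp i) (m : ℝ) (v : ℝ≥0) : s.respProb y m v ≤ 1 :=
  (integral_mono (s.integrable_prod_prob y m v) (integrable_const 1)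
    (s.prod_prob_le_one y)).trans_eq (by simp)

theorem Study.measurable_respProb (y : s.Resp i) (v : ℝ≥0) :
    Measurable fun m => s.respProb y m v :=
  (StronglyMeasurable.integral_kernel
    (κ := ⟨fun m => gaussianReal m v, measurable_gaussianReal.comp measurable_prodMk_right⟩)
    (s.measurable_prod_prob y).stronglyMeasurable).measurable

theorem PredictorKind.measurable_feature (k : PredictorKind) (l : ℕ) :
    Measurable (k.feature l) := by
  cases k with
  | continuous => exact measurable_id
  | categorical K => exact Measurable.ite measurableSet_Ici measurable_const measurable_const

theorem Study.measurable_linPred (s : Study N p J) (β : s.Slopes) : Measurable (s.linPred β) :=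
  Finset.measurable_sum _ fun j _ => Finset.measurable_sum _ fun _ _ =>
    ((PredictorKind.measurable_feature _ _).comp (measurable_pi_apply j)).const_mul _

theorem Model.resp_pos (P : Model s) (y : s.Resp i) (z : Fin p → ℝ) : 0 < P.resp y z :=
  s.respProb_pos _ _ _

theorem Model.resp_le_one (P : Model s) (y : s.Resp i) (z : Fin p → ℝ) : P.resp y z ≤ 1 :=
  s.respProb_le_one _ _ _

theorem Model.measurable_resp (P : Model s) (y : s.Resp i) :
    Measurable fun t => P.resp y (P.cop.transVec s t) :=
  (s.measurable_respProb y P.resVar).comp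
    (((s.measurable_linPred P.slope).comp (P.cop.measurable_transVec s)).const_add _)

end Response

/-! ### Densities of observed predictors and knockoffs -/

section Density

variable {N p J : ℕ} {s : Study N p J} {i : Fin N}

/-- The integrand of `Model.obsDensity`: the joint density of the underlying vector `t` and the
responses `y`. -/
def Model.integrand (P : Model s) (y : s.Resp i) (t : Fin p → ℝ) : ℝ :=
  gaussDensity P.cop.corr t * P.resp y (P.cop.transVec s t)

theorem Model.measurable_integrand (P : Model s) (y : s.Resp i) : Measurable (P.integrand y) :=
  (measurable_gaussDensity _).mul (P.measurable_resp y)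

variable {P Q : Model s}

theorem Model.Valid.integrand_pos (hP : P.Valid) (y : s.Resp i) (t : Fin p → ℝ) :
    0 < P.integrand y t :=
  mul_pos (gaussDensity_pos hP.cop.posDef t) (P.resp_pos y _)

theorem Model.Valid.integrable_integrand (hP : P.Valid) (A : Finset (Fin p))
    (z : Fin p → ℝ) (y : s.Resp i) : Integrable (P.integrand y) (P.cop.fibreVec s A z) :=
  Copula.integrable_fibreVec hP.cop.posDef (P.measurable_resp y) (fun _ => (P.resp_pos y _).le)
    (fun _ => P.resp_le_one y _) A z

theorem Model.Valid.ofReal_obsDensity (hP : P.Valid) (A : Finset (Fin p))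
    (z : Fin p → ℝ) (y : s.Resp i) :
    ENNReal.ofReal (P.obsDensity A z y) =
      ∫⁻ t, ENNReal.ofReal (P.integrand y t) ∂(P.cop.fibreVec s A z) :=
  ofReal_integral_eq_lintegral_ofReal (hP.integrable_integrand A z y)
    (ae_of_all _ fun t => (hP.integrand_pos y t).le)

theorem Model.measurable_obsDensity (P : Model s) (A : Finset (Fin p)) (y : s.Resp i) :
    Measurable fun z => P.obsDensity A z y := by
  have h := (StronglyMeasurable.integral_kernel (κ := P.cop.fibreKernel s A)
    (P.measurable_integrand y).stronglyMeasurable).measurable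
  simp only [Copula.fibreKernel_apply] at h
  exact h

theorem Model.Valid.obsDensity_nonneg (hP : P.Valid) (A : Finset (Fin p))
    (z : Fin p → ℝ) (y : s.Resp i) : 0 ≤ P.obsDensity A z y :=
  integral_nonneg fun t => (hP.integrand_pos y t).le

theorem Model.Valid.obsDensity_pos (hP : P.Valid) {A : Finset (Fin p)}
    {z : Fin p → ℝ} (hz : z ∈ s.support A) (y : s.Resp i) : 0 < P.obsDensity A z y :=
  integral_pos_of_forall_pos (hP.cop.fibreVec_ne_zero hz) (hP.integrand_pos y)
    (hP.integrable_integrand A z y)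

variable {S : Fin p → ℝ}

/-- The joint density of the underlying vectors `t` of the predictors and `t'` of the knockoffs
and the responses `y`. -/
def Model.pairIntegrand (Q : Model s) (S : Fin p → ℝ) (y : s.Resp i)
    (u : (Fin p → ℝ) × (Fin p → ℝ)) : ℝ :=
  gaussDensity (Q.cop.knockoffCov S) (Sum.elim u.1 u.2) * Q.resp y (Q.cop.transVec s u.1)

/-- The joint density of the observed predictors `z`, their knockoffs `z'` and the responses
`y`, that is, the numerator of `Model.knockoffDensity`. -/
def Model.jointDensity (Q : Model s) (S : Fin p → ℝ) (A : Finset (Fin p)) (z z' : Fin p → ℝ)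
    (y : s.Resp i) : ℝ :=
  ∫ u, Q.pairIntegrand S y u ∂((Q.cop.fibreVec s A z).prod (Q.cop.fibreVec s A z'))

theorem Model.knockoffDensity_eq_div (A : Finset (Fin p)) (z' z : Fin p → ℝ) (y : s.Resp i) :
    Q.knockoffDensity S A z' z y = Q.jointDensity S A z z' y / Q.obsDensity A z y := by
  simp only [Model.knockoffDensity, Copula.extDensity, Model.jointDensity, Model.pairIntegrand,
    Model.resp, Study.linPred, Pi.zero_apply, zero_mul, Finset.sum_const_zero, add_zero]

theorem Model.measurable_pairIntegrand (Q : Model s) (S : Fin p → ℝ) (y : s.Resp i) :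
    Measurable (Q.pairIntegrand S y) :=
  ((measurable_gaussDensity _).comp measurable_sumElim).mul
    ((Q.measurable_resp y).comp measurable_fst)

theorem Model.pairIntegrand_pos (hS : (Q.cop.knockoffCov S).PosDef) (y : s.Resp i)
    (u : (Fin p → ℝ) × (Fin p → ℝ)) : 0 < Q.pairIntegrand S y u :=
  mul_pos (gaussDensity_pos hS _) (Q.resp_pos y _)

theorem Model.integrable_pairIntegrand (hS : (Q.cop.knockoffCov S).PosDef) (A : Finset (Fin p))
    (z z' : Fin p → ℝ) (y : s.Resp i) :
    Integrable (Q.pairIntegrand S y) ((Q.cop.fibreVec s A z).prod (Q.cop.fibreVec s A z')) :=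
  Copula.integrable_fibreVec_prod hS ((Q.measurable_resp y).comp measurable_fst)
    (fun _ => (Q.resp_pos y _).le) (fun _ => Q.resp_le_one y _) A z z'

theorem Model.ofReal_jointDensity (hS : (Q.cop.knockoffCov S).PosDef) (A : Finset (Fin p))
    (z z' : Fin p → ℝ) (y : s.Resp i) :
    ENNReal.ofReal (Q.jointDensity S A z z' y) =
      ∫⁻ t, ∫⁻ t', ENNReal.ofReal (Q.pairIntegrand S y (t, t')) ∂(Q.cop.fibreVec s A z')
        ∂(Q.cop.fibreVec s A z) := by
  rw [Model.jointDensity, ofReal_integral_eq_lintegral_ofReal (integrable_pairIntegrand hS A z z' y)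
    (ae_of_all _ fun u => (pairIntegrand_pos hS y u).le),
    lintegral_prod _ (Q.measurable_pairIntegrand S y).ennreal_ofReal.aemeasurable]

theorem Model.measurable_jointDensity (Q : Model s) (S : Fin p → ℝ) (A : Finset (Fin p))
    (y : s.Resp i) :
    Measurable fun u : (Fin p → ℝ) × (Fin p → ℝ) => Q.jointDensity S A u.1 u.2 y := by
  have h := (StronglyMeasurable.integral_kernel
    (κ := Q.cop.fibreKernel s A ∥ₖ Q.cop.fibreKernel s A)
    (Q.measurable_pairIntegrand S y).stronglyMeasurable).measurable
  simp only [Kernel.parallelComp_apply, Copula.fibreKernel_apply] at h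
  exact h

theorem Model.Valid.jointDensity_pos (hQ : Q.Valid) (hS : (Q.cop.knockoffCov S).PosDef)
    {A : Finset (Fin p)} {z z' : Fin p → ℝ} (hz : z ∈ s.support A) (hz' : z' ∈ s.support A)
    (y : s.Resp i) : 0 < Q.jointDensity S A z z' y := by
  have hne : (Q.cop.fibreVec s A z).prod (Q.cop.fibreVec s A z') ≠ 0 := by
    rw [← Measure.measure_univ_ne_zero, ← Set.univ_prod_univ, Measure.prod_prod]
    exact mul_ne_zero (Measure.measure_univ_ne_zero.2 (hQ.cop.fibreVec_ne_zero hz))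
      (Measure.measure_univ_ne_zero.2 (hQ.cop.fibreVec_ne_zero hz'))
  exact integral_pos_of_forall_pos hne (pairIntegrand_pos hS y)
    (integrable_pairIntegrand hS A z z' y)

theorem Model.measurable_knockoffDensity (Q : Model s) (S : Fin p → ℝ)
    (A : Finset (Fin p)) (y : s.Resp i) :
    Measurable fun u : (Fin p → ℝ) × (Fin p → ℝ) => Q.knockoffDensity S A u.2 u.1 y := by
  simp_rw [knockoffDensity_eq_div]
  exact (Q.measurable_jointDensity S A y).div ((Q.measurable_obsDensity A y).comp measurable_fst)

theorem Model.Valid.knockoffDensity_pos (hQ : Q.Valid) (hS : (Q.cop.knockoffCov S).PosDef)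
    {A : Finset (Fin p)} {z z' : Fin p → ℝ} (hz : z ∈ s.support A) (hz' : z' ∈ s.support A)
    (y : s.Resp i) : 0 < Q.knockoffDensity S A z' z y := by
  rw [knockoffDensity_eq_div]
  exact div_pos (hQ.jointDensity_pos hS hz hz' y) (hQ.obsDensity_pos hz y)

end Density

/-! ### The law of the observed data -/

section ObservedLaw

variable {N p J : ℕ} {s : Study N p J} {i : Fin N}

theorem Study.measurable_obs {β : Type*} [MeasurableSpace β] {f : s.Obs i → β}
    (hf : ∀ A y, Measurable fun z => f (A, z, y)) : Measurable f :=
  measurable_from_prod_countable_right fun A => measurable_from_prod_countable_left fun y => hf A y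

theorem Study.measurable_pairObs {β : Type*} [MeasurableSpace β] {f : s.PairObs i → β}
    (hf : ∀ A y, Measurable fun u : (Fin p → ℝ) × (Fin p → ℝ) => f ((A, u.1, y), u.2)) :
    Measurable f := by
  have hreorder : Measurable fun d : s.PairObs i =>
      ((d.1.1, d.1.2.2), (d.1.2.1, d.2)) := by fun_prop
  have hreordered : Measurable
      fun x : (Finset (Fin p) × s.Resp i) × ((Fin p → ℝ) × (Fin p → ℝ)) =>
        f ((x.1.1, x.2.1, x.1.2), x.2.2) :=
    measurable_from_prod_countable_right fun x => hf x.1 x.2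
  exact hreordered.comp hreorder

theorem Copula.measurable_record (c : Copula p) : Measurable
    fun x : (Fin p → ℝ) × s.Resp i × Finset (Fin p) =>
      ((x.2.2, mask x.2.2 (c.transVec s x.1), x.2.1) : s.Obs i) :=
  measurable_from_prod_countable_left fun x => (measurable_const (a := x.2)).prodMk
    (((measurable_mask x.2).comp (c.measurable_transVec s)).prodMk (measurable_const (a := x.1)))

variable {P Q : Model s} {q : Fin N → Finset (Fin p) → (Fin p → ℝ) → ℝ}

theorem SMAR.mask_eq {T : Finset (Fin p)} (h : SMAR q T) (i : Fin N) (A : Finset (Fin p))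
    (z : Fin p → ℝ) : q i A (mask A z) = q i A z :=
  h i A _ _ fun j hj => by simp [mask, Finset.mem_of_mem_inter_left hj]

theorem IsMissingness.le_one (hq : IsMissingness q) (i : Fin N) (A : Finset (Fin p))
    (z : Fin p → ℝ) : q i A z ≤ 1 :=
  (Finset.single_le_sum (fun A _ => hq.nonneg i A z) (Finset.mem_univ A)).trans_eq
    (hq.sum_eq_one i z)

theorem Model.lintegral_obsLaw_eq_lintegral_volume (P : Model s) (hq : IsMissingness q)
    {φ : s.Obs i → ℝ≥0∞} (hφ : Measurable φ) :
    ∫⁻ x, φ x ∂(P.obsLaw q i) = ∑ A, ∑ y, ∫⁻ t,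
      ENNReal.ofReal (P.integrand y t * q i A (P.cop.transVec s t)) *
        φ (A, mask A (P.cop.transVec s t), y) := by
  have hw : Measurable fun x : (Fin p → ℝ) × s.Resp i × Finset (Fin p) =>
      ENNReal.ofReal (P.integrand x.2.1 x.1 * q i x.2.2 (P.cop.transVec s x.1)) :=
    measurable_from_prod_countable_left fun x => ((P.measurable_integrand x.1).mul
      ((hq.measurable i x.2).comp (P.cop.measurable_transVec s))).ennreal_ofReal
  have hφm := hφ.comp P.cop.measurable_record
  have hwφ := hw.mul hφm
  rw [obsLaw, lintegral_map hφ P.cop.measurable_record]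
  refine (lintegral_withDensity_eq_lintegral_mul _ hw hφm).trans ?_
  rw [lintegral_prod_symm _ hwφ.aemeasurable,
    lintegral_prod_symm _ (Measurable.lintegral_prod_left' hwφ).aemeasurable,
    lintegral_count, tsum_fintype]
  refine Finset.sum_congr rfl fun A _ => ?_
  rw [lintegral_count, tsum_fintype]
  rfl

theorem Model.Valid.isFiniteMeasure_obsLaw (hP : P.Valid) (hq : IsMissingness q) :
    IsFiniteMeasure (P.obsLaw q i) := by
  have hle (A : Finset (Fin p)) (y : s.Resp i) (t : Fin p → ℝ) :
      P.integrand y t * q i A (P.cop.transVec s t) ≤ gaussDensity P.cop.corr t :=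
    (mul_le_of_le_one_right (hP.integrand_pos y t).le (hq.le_one i A _)).trans
      (mul_le_of_le_one_right (gaussDensity_pos hP.cop.posDef t).le (P.resp_le_one y _))
  refine ⟨?_⟩
  rw [← lintegral_one, P.lintegral_obsLaw_eq_lintegral_volume hq (φ := fun _ => 1) measurable_const]
  refine ENNReal.sum_lt_top.2 fun A _ => ENNReal.sum_lt_top.2 fun y _ => ?_
  simp only [mul_one]
  exact (lintegral_mono fun t => ENNReal.ofReal_le_ofReal (hle A y t)).trans_lt
    ((lintegral_gaussDensity hP.cop.posDef).trans_lt ENNReal.one_lt_top)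

theorem Model.Valid.lintegral_obsLaw (hP : P.Valid) (hq : IsMissingness q) {T : Finset (Fin p)}
    (hT : SMAR q T) {φ : s.Obs i → ℝ≥0∞} (hφ : Measurable φ) :
    ∫⁻ x, φ x ∂(P.obsLaw q i) = ∑ A, ∑ y, ∫⁻ z,
      ENNReal.ofReal (P.obsDensity A z y * q i A z) * φ (A, z, y) ∂(s.obsBase A) := by
  rw [P.lintegral_obsLaw_eq_lintegral_volume hq hφ]
  refine Finset.sum_congr rfl fun A _ => Finset.sum_congr rfl fun y _ => ?_
  have hg := (P.measurable_integrand y).ennreal_ofReal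
  have hqφ : Measurable fun z => ENNReal.ofReal (q i A z) * φ (A, z, y) :=
    (hq.measurable i A).ennreal_ofReal.mul (hφ.comp (by fun_prop))
  calc ∫⁻ t, ENNReal.ofReal (P.integrand y t * q i A (P.cop.transVec s t)) *
        φ (A, mask A (P.cop.transVec s t), y)
    _ = ∫⁻ t, ENNReal.ofReal (P.integrand y t) *
          (ENNReal.ofReal (q i A (mask A (P.cop.transVec s t))) *
            φ (A, mask A (P.cop.transVec s t), y)) := by
        simp only [hT.mask_eq, ENNReal.ofReal_mul (hP.integrand_pos y _).le, mul_assoc]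
    _ = ∫⁻ z, ∫⁻ t, ENNReal.ofReal (P.integrand y t) *
          (ENNReal.ofReal (q i A z) * φ (A, z, y)) ∂(P.cop.fibreVec s A z) ∂(s.obsBase A) :=
        (hP.cop.lintegral_fibreVec A (φ := fun x => ENNReal.ofReal (P.integrand y x.2) *
          (ENNReal.ofReal (q i A x.1) * φ (A, x.1, y)))
          ((hg.comp measurable_snd).mul (hqφ.comp measurable_fst))).symm
    _ = ∫⁻ z, ENNReal.ofReal (P.obsDensity A z y * q i A z) * φ (A, z, y) ∂(s.obsBase A) := by
        simp only [lintegral_mul_const _ hg, ← hP.ofReal_obsDensity,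
          ENNReal.ofReal_mul (hP.obsDensity_nonneg A _ y), mul_assoc]

theorem Model.Valid.ae_obsLaw_obsDensity_pos (hQ : Q.Valid) (P : Model s)
    (q : Fin N → Finset (Fin p) → (Fin p → ℝ) → ℝ) (i : Fin N) :
    ∀ᵐ x ∂(P.obsLaw q i), 0 < Q.obsDensity x.1 x.2.1 x.2.2 := by
  have hmeas : Measurable fun x : s.Obs i => Q.obsDensity x.1 x.2.1 x.2.2 :=
    Study.measurable_obs Q.measurable_obsDensity
  rw [Model.obsLaw, ae_map_iff P.cop.measurable_record.aemeasurable
    (measurableSet_lt measurable_const hmeas)]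
  exact ae_of_all _ fun x =>
    hQ.obsDensity_pos (P.cop.mask_transVec_mem_support s x.2.2 x.1) x.2.1

end ObservedLaw

/-! ### The law of the knockoffs -/

section KnockoffLaw

variable {N p J : ℕ} {s : Study N p J} {i : Fin N} {Q : Model s} {S : Fin p → ℝ}

theorem Model.measurable_posterior (Q : Model s) :
    Measurable fun x : s.Obs i => Q.posterior x := by
  refine Study.measurable_obs fun A y => ?_
  have hg : Measurable (Function.uncurry fun (_ : Fin p → ℝ) t =>
      ENNReal.ofReal (Q.integrand y t)) :=
    (Q.measurable_integrand y).ennreal_ofReal.comp measurable_snd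
  have hm : Measurable fun z => (Q.cop.fibreVec s A z).withDensity fun t =>
      ENNReal.ofReal (Q.integrand y t) := by
    simp only [← Copula.fibreKernel_apply, ← Kernel.withDensity_apply _ hg]
    exact Kernel.measurable _
  refine Measure.measurable_of_measurable_coe _ fun B hB => ?_
  exact ((Measure.measurable_coe .univ).comp hm).inv.mul ((Measure.measurable_coe hB).comp hm)

theorem Model.posterior_univ_le_one (Q : Model s) (x : s.Obs i) :
    Q.posterior x Set.univ ≤ 1 :=
  ENNReal.inv_mul_le_one _

theorem Model.Valid.lintegral_posterior (hQ : Q.Valid) (x : s.Obs i)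
    {f : (Fin p → ℝ) → ℝ≥0∞} (hf : Measurable f) :
    ∫⁻ t, f t ∂(Q.posterior x) = (ENNReal.ofReal (Q.obsDensity x.1 x.2.1 x.2.2))⁻¹ *
      ∫⁻ t, ENNReal.ofReal (Q.integrand x.2.2 t) * f t ∂(Q.cop.fibreVec s x.1 x.2.1) := by
  have hpost : Q.posterior x = (ENNReal.ofReal (Q.obsDensity x.1 x.2.1 x.2.2))⁻¹ •
      (Q.cop.fibreVec s x.1 x.2.1).withDensity fun t => ENNReal.ofReal (Q.integrand x.2.2 t) := by
    rw [hQ.ofReal_obsDensity, ← setLIntegral_univ, ← withDensity_apply _ .univ]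
    rfl
  rw [hpost, lintegral_smul_measure, smul_eq_mul,
    lintegral_withDensity_eq_lintegral_mul _ (Q.measurable_integrand x.2.2).ennreal_ofReal hf]
  rfl

theorem Model.Valid.posterior_univ (hQ : Q.Valid) {x : s.Obs i}
    (hx : 0 < Q.obsDensity x.1 x.2.1 x.2.2) : Q.posterior x Set.univ = 1 := by
  rw [← lintegral_one, hQ.lintegral_posterior x (f := fun _ => 1) measurable_const]
  simp only [mul_one, ← hQ.ofReal_obsDensity]
  exact ENNReal.inv_mul_cancel (by simpa using hx) ENNReal.ofReal_ne_top

theorem Copula.measurable_knockoffStep (c : Copula p) (S : Fin p → ℝ) :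
    Measurable (c.knockoffStep S) := by
  have h : Measurable (Function.uncurry fun t t' : Fin p → ℝ =>
      ENNReal.ofReal (gaussDensity (c.knockoffCov S) (Sum.elim t t') / gaussDensity c.corr t)) :=
    (((measurable_gaussDensity _).comp measurable_sumElim).div
      ((measurable_gaussDensity _).comp measurable_fst)).ennreal_ofReal
  refine Measure.measurable_of_measurable_coe _ fun B hB => ?_
  simp only [Copula.knockoffStep, withDensity_apply _ hB]
  exact h.lintegral_prod_right'

theorem Copula.Valid.knockoffStep_univ {c : Copula p} (hc : c.Valid s)
    (hS : (c.knockoffCov S).PosDef) (t : Fin p → ℝ) : c.knockoffStep S t Set.univ = 1 := by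
  have hB : (c.corr - Matrix.diagonal S).transpose = c.corr - Matrix.diagonal S := by
    rw [Matrix.transpose_sub, Matrix.diagonal_transpose,
      ← Matrix.conjTranspose_eq_transpose_of_trivial, hc.posDef.isHermitian.eq]
  have h := lintegral_gaussDensity_fromBlocks (A := c.corr) (B := c.corr - Matrix.diagonal S)
    (D := c.corr) (by rw [hB]; exact hS) hc.posDef t
  rw [hB] at h
  rw [Copula.knockoffStep, withDensity_apply _ .univ, Measure.restrict_univ]
  exact h

theorem Model.Valid.ofReal_integrand_mul_lintegral_knockoffStep (hQ : Q.Valid) (y : s.Resp i)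
    {φ : (Fin p → ℝ) → ℝ≥0∞} (hφ : Measurable φ) (t : Fin p → ℝ) :
    ENNReal.ofReal (Q.integrand y t) * ∫⁻ t', φ t' ∂(Q.cop.knockoffStep S t) =
      ∫⁻ t', ENNReal.ofReal (Q.pairIntegrand S y (t, t')) * φ t' := by
  have hd : Measurable fun t' => ENNReal.ofReal
      (gaussDensity (Q.cop.knockoffCov S) (Sum.elim t t') / gaussDensity Q.cop.corr t) :=
    (((measurable_gaussDensity _).comp (measurable_sumElim.comp measurable_prodMk_left)).div_const
      _).ennreal_ofReal
  have hg := gaussDensity_pos hQ.cop.posDef t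
  rw [Copula.knockoffStep, lintegral_withDensity_eq_lintegral_mul _ hd hφ,
    ← lintegral_const_mul _ (hd.mul hφ)]
  refine lintegral_congr fun t' => ?_
  rw [Pi.mul_apply, ← mul_assoc, ← ENNReal.ofReal_mul (hQ.integrand_pos y t).le]
  congr 2
  simp only [Model.pairIntegrand, Model.integrand]
  field_simp

theorem Model.Valid.lintegral_jointDensity_mul (hQ : Q.Valid) (hS : (Q.cop.knockoffCov S).PosDef)
    (A : Finset (Fin p)) (z : Fin p → ℝ) (y : s.Resp i) {φ : (Fin p → ℝ) → ℝ≥0∞}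
    (hφ : Measurable φ) :
    ∫⁻ z', ENNReal.ofReal (Q.jointDensity S A z z' y) * φ z' ∂(s.obsBase A) =
      ∫⁻ t, (∫⁻ t', ENNReal.ofReal (Q.pairIntegrand S y (t, t')) *
        φ (mask A (Q.cop.transVec s t'))) ∂(Q.cop.fibreVec s A z) := by
  have hI := (Q.measurable_pairIntegrand S y).ennreal_ofReal
  have hK : Measurable fun x : (Fin p → ℝ) × (Fin p → ℝ) =>
      ∫⁻ t', ENNReal.ofReal (Q.pairIntegrand S y (x.2, t')) * φ x.1
        ∂((Q.cop.fibreKernel s A).comap Prod.fst measurable_fst x) :=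
    Measurable.lintegral_kernel_prod_right'
      (κ := (Q.cop.fibreKernel s A).comap Prod.fst measurable_fst) (f := fun v =>
      ENNReal.ofReal (Q.pairIntegrand S y (v.1.2, v.2)) * φ v.1.1)
      ((hI.comp (by fun_prop)).mul (hφ.comp (by fun_prop)))
  simp only [Kernel.comap_apply, Copula.fibreKernel_apply] at hK
  calc ∫⁻ z', ENNReal.ofReal (Q.jointDensity S A z z' y) * φ z' ∂(s.obsBase A)
    _ = ∫⁻ z', ∫⁻ t, ∫⁻ t', ENNReal.ofReal (Q.pairIntegrand S y (t, t')) * φ z'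
          ∂(Q.cop.fibreVec s A z') ∂(Q.cop.fibreVec s A z) ∂(s.obsBase A) := by
        refine lintegral_congr fun z' => ?_
        rw [ofReal_jointDensity hS, ← lintegral_mul_const _ (Measurable.lintegral_prod_right' hI)]
        exact lintegral_congr fun t =>
          (lintegral_mul_const _ (hI.comp measurable_prodMk_left)).symm
    _ = ∫⁻ t, ∫⁻ z', ∫⁻ t', ENNReal.ofReal (Q.pairIntegrand S y (t, t')) * φ z'
          ∂(Q.cop.fibreVec s A z') ∂(s.obsBase A) ∂(Q.cop.fibreVec s A z) :=
        lintegral_lintegral_swap hK.aemeasurable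
    _ = _ := lintegral_congr fun t =>
        hQ.cop.lintegral_fibreVec A
          (φ := fun v => ENNReal.ofReal (Q.pairIntegrand S y (t, v.2)) * φ v.1)
          ((hI.comp (measurable_const.prodMk measurable_snd)).mul (hφ.comp measurable_fst))

theorem Model.measurable_knockoffLaw (Q : Model s) (S : Fin p → ℝ) :
    Measurable fun x : s.Obs i => Q.knockoffLaw S x :=
  Study.measurable_obs fun A _ =>
    (Measure.measurable_map _ ((measurable_mask A).comp (Q.cop.measurable_transVec s))).comp
      ((Measure.measurable_bind' (Q.cop.measurable_knockoffStep S)).comp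
        (Q.measurable_posterior.comp (by fun_prop)))

theorem Model.lintegral_knockoffLaw (Q : Model s) (S : Fin p → ℝ) (x : s.Obs i)
    {φ : (Fin p → ℝ) → ℝ≥0∞} (hφ : Measurable φ) :
    ∫⁻ z', φ z' ∂(Q.knockoffLaw S x) = ∫⁻ t, ∫⁻ t', φ (mask x.1 (Q.cop.transVec s t'))
      ∂(Q.cop.knockoffStep S t) ∂(Q.posterior x) := by
  have hm : Measurable fun t => mask x.1 (Q.cop.transVec s t) :=
    (measurable_mask x.1).comp (Q.cop.measurable_transVec s)
  have hφm : Measurable fun t => φ (mask x.1 (Q.cop.transVec s t)) := hφ.comp hm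
  rw [Model.knockoffLaw, lintegral_map hφ hm, Measure.lintegral_bind
    (Q.cop.measurable_knockoffStep S).aemeasurable hφm.aemeasurable]

theorem Model.Valid.knockoffLaw_univ (hQ : Q.Valid) (hS : (Q.cop.knockoffCov S).PosDef)
    (x : s.Obs i) : Q.knockoffLaw S x Set.univ = Q.posterior x Set.univ := by
  rw [← lintegral_one, lintegral_knockoffLaw Q S x (φ := fun _ => 1) measurable_const]
  simp only [lintegral_one, hQ.cop.knockoffStep_univ hS]

theorem Model.Valid.lintegral_knockoffLaw_eq (hQ : Q.Valid) (hS : (Q.cop.knockoffCov S).PosDef)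
    {x : s.Obs i} (hx : 0 < Q.obsDensity x.1 x.2.1 x.2.2) {φ : (Fin p → ℝ) → ℝ≥0∞}
    (hφ : Measurable φ) :
    ∫⁻ z', φ z' ∂(Q.knockoffLaw S x) =
      ∫⁻ z', ENNReal.ofReal (Q.knockoffDensity S x.1 z' x.2.1 x.2.2) * φ z' ∂(s.obsBase x.1) := by
  obtain ⟨A, z, y⟩ := x
  have hφF : Measurable fun t => φ (mask A (Q.cop.transVec s t)) :=
    hφ.comp ((measurable_mask A).comp (Q.cop.measurable_transVec s))
  have hJφ : Measurable fun z' => ENNReal.ofReal (Q.jointDensity S A z z' y) * φ z' :=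
    ((Q.measurable_jointDensity S A y).comp measurable_prodMk_left).ennreal_ofReal.mul hφ
  have hstep : Measurable fun t =>
      ∫⁻ t', φ (mask A (Q.cop.transVec s t')) ∂(Q.cop.knockoffStep S t) :=
    (Measure.measurable_lintegral hφF).comp (Q.cop.measurable_knockoffStep S)
  rw [Q.lintegral_knockoffLaw S _ hφ, hQ.lintegral_posterior _ hstep]
  simp only [hQ.ofReal_integrand_mul_lintegral_knockoffStep y hφF]
  rw [← hQ.lintegral_jointDensity_mul hS A z y hφ, ← lintegral_const_mul _ hJφ]
  refine lintegral_congr fun z' => ?_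
  rw [knockoffDensity_eq_div, ENNReal.ofReal_div_of_pos hx, div_eq_mul_inv, ← mul_assoc,
    mul_comm (ENNReal.ofReal _)⁻¹]

/-- `Model.knockoffLaw` as a kernel. -/
def Model.knockoffKernel (Q : Model s) (S : Fin p → ℝ) (i : Fin N) :
    Kernel (s.Obs i) (Fin p → ℝ) :=
  ⟨Q.knockoffLaw S, Q.measurable_knockoffLaw S⟩

theorem Model.Valid.isFiniteKernel_knockoffKernel (hQ : Q.Valid)
    (hS : (Q.cop.knockoffCov S).PosDef) : IsFiniteKernel (Q.knockoffKernel S i) :=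
  ⟨1, ENNReal.one_lt_top, fun x =>
    (hQ.knockoffLaw_univ hS x).trans_le (Q.posterior_univ_le_one x)⟩

theorem Model.Valid.isProbabilityMeasure_knockoffKernel (hQ : Q.Valid)
    (hS : (Q.cop.knockoffCov S).PosDef) {x : s.Obs i}
    (hx : 0 < Q.obsDensity x.1 x.2.1 x.2.2) : IsProbabilityMeasure (Q.knockoffKernel S i x) :=
  ⟨(hQ.knockoffLaw_univ hS x).trans (hQ.posterior_univ hx)⟩

end KnockoffLaw

/-! ### The law of the data of one run -/

section RunLaw

theorem bind_map_prodMk {α β : Type*} {mα : MeasurableSpace α} {mβ : MeasurableSpace β}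
    (μ : Measure α) [SFinite μ] (κ : Kernel α β) [IsSFiniteKernel κ] :
    (μ.bind fun a => (κ a).map (Prod.mk a)) = μ ⊗ₘ κ := by
  rw [Measure.compProd_eq_comp_prod]
  congr 1
  ext1 a
  rw [Kernel.prod_apply, Kernel.id_apply, Measure.dirac_prod]

variable {N p J : ℕ} {s : Study N p J} {i : Fin N} {P Q : Model s} {S : Fin p → ℝ}
  {q : Fin N → Finset (Fin p) → (Fin p → ℝ) → ℝ}

/-- The law of the observed data of student `i` and the knockoffs of a single run. -/
def pairLaw (P Q : Model s) (S : Fin p → ℝ) (q : Fin N → Finset (Fin p) → (Fin p → ℝ) → ℝ)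
    (i : Fin N) : Measure (s.PairObs i) :=
  P.obsLaw q i ⊗ₘ Q.knockoffKernel S i

theorem isFiniteMeasure_pairLaw (hP : P.Valid) (hQ : Q.Valid)
    (hS : (Q.cop.knockoffCov S).PosDef) (hq : IsMissingness q) :
    IsFiniteMeasure (pairLaw P Q S q i) := by
  have := hP.isFiniteMeasure_obsLaw (i := i) hq
  have := hQ.isFiniteKernel_knockoffKernel (i := i) hS
  unfold pairLaw
  infer_instance

theorem map_runs_eq_pairLaw (hP : P.Valid) (hQ : Q.Valid) (hS : (Q.cop.knockoffCov S).PosDef)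
    (hq : IsMissingness q) {M : ℕ} (m : Fin M) :
    ((P.obsLaw q i).bind fun x =>
      (Measure.pi fun _ : Fin M => Q.knockoffLaw S x).map (Prod.mk x)).map
        (Prod.map id fun k => k m) = pairLaw P Q S q i := by
  have := hP.isFiniteMeasure_obsLaw (i := i) hq
  have := hQ.isFiniteKernel_knockoffKernel (i := i) hS
  have hruns : ((P.obsLaw q i).bind fun x =>
      (Measure.pi fun _ : Fin M => Q.knockoffLaw S x).map (Prod.mk x)) =
        P.obsLaw q i ⊗ₘ piKernel fun _ : Fin M => Q.knockoffKernel S i := by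
    rw [← bind_map_prodMk]
    simp only [piKernel_apply]
    rfl
  rw [hruns, ← Measure.compProd_map (measurable_pi_apply m)]
  refine Measure.compProd_congr ?_
  filter_upwards [hQ.ae_obsLaw_obsDensity_pos P q i] with x hx
  have := hQ.isProbabilityMeasure_knockoffKernel hS hx
  rw [Kernel.map_apply _ (measurable_pi_apply m), piKernel_apply]
  exact (measurePreserving_eval (fun _ : Fin M => Q.knockoffKernel S i x) m).map_eq

theorem map_studyLaw (hP : P.Valid) (hQ : Q.Valid) (hS : (Q.cop.knockoffCov S).PosDef)
    (hq : IsMissingness q) {M : ℕ} (m : Fin M) :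
    (studyLaw P Q S q M).map (fun d i => ((d i).1, (d i).2 m)) =
      Measure.pi fun i => pairLaw P Q S q i := by
  have hrun := fun i => map_runs_eq_pairLaw (i := i) hP hQ hS hq m
  have hσ (i : Fin N) : SigmaFinite (((P.obsLaw q i).bind fun x =>
      (Measure.pi fun _ : Fin M => Q.knockoffLaw S x).map (Prod.mk x)).map
        (Prod.map id fun k => k m)) := by
    have := isFiniteMeasure_pairLaw (i := i) hP hQ hS hq
    rw [hrun]
    infer_instance
  rw [studyLaw, ← funext hrun]
  exact Measure.pi_map_pi (hμ := hσ) fun i => Measurable.aemeasurable (by fun_prop)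

/-- The density of `pairLaw`. -/
def pairDensity (P Q : Model s) (S : Fin p → ℝ) (q : Fin N → Finset (Fin p) → (Fin p → ℝ) → ℝ)
    (A : Finset (Fin p)) (y : s.Resp i) (u : (Fin p → ℝ) × (Fin p → ℝ)) : ℝ :=
  P.obsDensity A u.1 y * q i A u.1 * Q.knockoffDensity S A u.2 u.1 y

theorem measurable_pairDensity (P Q : Model s) (S : Fin p → ℝ) (hq : IsMissingness q)
    (A : Finset (Fin p)) (y : s.Resp i) : Measurable (pairDensity P Q S q A y) :=
  (((P.measurable_obsDensity A y).mul (hq.measurable i A)).comp measurable_fst).mul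
    (Q.measurable_knockoffDensity S A y)

theorem lintegral_pairLaw (hP : P.Valid) (hQ : Q.Valid) (hS : (Q.cop.knockoffCov S).PosDef)
    (hq : IsMissingness q) {T : Finset (Fin p)} (hT : SMAR q T) {φ : s.PairObs i → ℝ≥0∞}
    (hφ : Measurable φ) :
    ∫⁻ d, φ d ∂(pairLaw P Q S q i) = ∑ A, ∑ y, ∫⁻ u,
      ENNReal.ofReal (pairDensity P Q S q A y u) * φ ((A, u.1, y), u.2)
        ∂((s.obsBase A).prod (s.obsBase A)) := by
  have := hP.isFiniteMeasure_obsLaw (i := i) hq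
  have := hQ.isFiniteKernel_knockoffKernel (i := i) hS
  rw [pairLaw, Measure.lintegral_compProd hφ,
    hP.lintegral_obsLaw hq hT (Measurable.lintegral_kernel_prod_right' hφ)]
  refine Finset.sum_congr rfl fun A _ => Finset.sum_congr rfl fun y _ => ?_
  have hdensity : Measurable fun u : (Fin p → ℝ) × (Fin p → ℝ) =>
      ENNReal.ofReal (pairDensity P Q S q A y u) * φ ((A, u.1, y), u.2) :=
    (measurable_pairDensity P Q S hq A y).ennreal_ofReal.mul (hφ.comp (by fun_prop))
  rw [lintegral_prod _ hdensity.aemeasurable]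
  refine lintegral_congr_ae ?_
  filter_upwards [s.ae_mem_support A] with z hz
  have hφz : Measurable fun z' => φ ((A, z, y), z') := hφ.comp measurable_prodMk_left
  have hk : Measurable fun z' => ENNReal.ofReal (Q.knockoffDensity S A z' z y) :=
    ((Q.measurable_knockoffDensity S A y).comp measurable_prodMk_left).ennreal_ofReal
  have hkernel := hQ.lintegral_knockoffLaw_eq hS (x := (A, z, y)) (hQ.obsDensity_pos hz y) hφz
  refine (congrArg _ hkernel).trans ((lintegral_const_mul _ (hk.mul hφz)).symm.trans ?_)
  refine lintegral_congr fun z' => ?_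
  rw [pairDensity, ENNReal.ofReal_mul (mul_nonneg (hP.obsDensity_nonneg A z y)
    (hq.nonneg i A z)), mul_assoc]
  rfl

end RunLaw

/-! ### Swapping a null predictor with its knockoff -/

section Swap

variable {N p J : ℕ} {s : Study N p J} {i : Fin N}

/-- `swapPair` for a single student: exchange the observed predictors in `T` with their
knockoffs. -/
def swapObs (T : Finset (Fin p)) (d : s.PairObs i) : s.PairObs i :=
  ((d.1.1, fun j => if j ∈ T ∧ j ∈ d.1.1 then d.2 j else d.1.2.1 j, d.1.2.2),
    fun j => if j ∈ T ∧ j ∈ d.1.1 then d.1.2.1 j else d.2 j)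

theorem swapObs_mk (T A : Finset (Fin p)) (y : s.Resp i) (u : (Fin p → ℝ) × (Fin p → ℝ)) :
    swapObs T (((A, u.1, y), u.2) : s.PairObs i) =
      ((A, (swapCoord (T ∩ A) u).1, y), (swapCoord (T ∩ A) u).2) := by
  ext k <;> simp [swapObs, swapCoord, Finset.piecewise]

theorem measurable_swapObs (T : Finset (Fin p)) :
    Measurable (swapObs T : s.PairObs i → s.PairObs i) := by
  refine Study.measurable_pairObs fun A y => ?_
  have hmk : Measurable fun u : (Fin p → ℝ) × (Fin p → ℝ) =>
      (((A, u.1, y), u.2) : s.PairObs i) := by fun_prop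
  simp only [swapObs_mk]
  exact hmk.comp (measurable_swapCoord (T ∩ A))

theorem measurable_swapPair (T : Finset (Fin p)) :
    Measurable (swapPair T : ((i : Fin N) → s.PairObs i) → _) :=
  measurable_pi_lambda _ fun i => (measurable_swapObs T).comp (measurable_pi_apply i)

/-- The contribution of one student to the observed divergence `KLhat`. -/
def klTerm (P Q : Model s) (S : Fin p → ℝ) (j : Fin p) (d : s.PairObs i) : ℝ :=
  if j ∈ d.1.1 then
    Real.log
      ((P.condDensity d.1.1 j (d.1.2.1 j) d.1.2.1 d.1.2.2 *
          Q.knockoffDensity S d.1.1 d.2 d.1.2.1 d.1.2.2) /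
        (P.condDensity d.1.1 j (d.2 j) d.1.2.1 d.1.2.2 *
          Q.knockoffDensity S d.1.1 (Function.update d.2 j (d.1.2.1 j))
            (Function.update d.1.2.1 j (d.2 j)) d.1.2.2))
  else 0

theorem KLhat_eq_sum (P Q : Model s) (S : Fin p → ℝ) (j : Fin p)
    (d : (i : Fin N) → s.PairObs i) : KLhat P Q S j d = ∑ i, klTerm P Q S j (d i) := rfl

theorem measurable_klTerm (P Q : Model s) (S : Fin p → ℝ) (j : Fin p) :
    Measurable (klTerm P Q S j : s.PairObs i → ℝ) := by
  refine Study.measurable_pairObs fun A y => ?_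
  by_cases hj : j ∈ A
  · simp only [klTerm, hj, if_true, Model.condDensity, Function.update_eq_self]
    have hP := P.measurable_obsDensity A y
    have hPerase := P.measurable_obsDensity (A.erase j) y
    have hQ := Q.measurable_knockoffDensity S A y
    have hz : Measurable fun u : (Fin p → ℝ) × (Fin p → ℝ) => Function.update u.1 j (u.2 j) := by
      fun_prop
    have hz' : Measurable fun u : (Fin p → ℝ) × (Fin p → ℝ) => Function.update u.2 j (u.1 j) := by
      fun_prop
    exact ((((hP.comp measurable_fst).div (hPerase.comp measurable_fst)).mul hQ).div
      (((hP.comp hz).div (hPerase.comp measurable_fst)).mul (hQ.comp (hz.prodMk hz')))).log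
  · simp only [klTerm, hj, if_false]
    exact measurable_const

theorem measurable_KLhat (P Q : Model s) (S : Fin p → ℝ) (j : Fin p) :
    Measurable (KLhat P Q S j : ((i : Fin N) → s.PairObs i) → ℝ) :=
  Finset.measurable_fun_sum _ fun i _ => (measurable_klTerm P Q S j).comp (measurable_pi_apply i)

variable {P Q : Model s} {S : Fin p → ℝ} {q : Fin N → Finset (Fin p) → (Fin p → ℝ) → ℝ}

theorem pairDensity_eq_exp_klTerm_mul (hP : P.Valid) (hQ : Q.Valid)
    (hS : (Q.cop.knockoffCov S).PosDef) {T : Finset (Fin p)} (hT : SMAR q T) {j : Fin p}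
    (hj : j ∉ T) {A : Finset (Fin p)} (y : s.Resp i) {u : (Fin p → ℝ) × (Fin p → ℝ)}
    (hz : u.1 ∈ s.support A) (hz' : u.2 ∈ s.support A) :
    pairDensity P Q S q A y u = Real.exp (klTerm P Q S j (((A, u.1, y), u.2) : s.PairObs i)) *
      pairDensity P Q S q A y (swapCoord ({j} ∩ A) u) := by
  by_cases hjA : j ∈ A
  · have hswap := Study.swapCoord_mem_support hz hz' {j}
    rw [Finset.singleton_inter_of_mem hjA]
    obtain ⟨z, z'⟩ := u
    rw [swapCoord_singleton] at hswap ⊢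
    have hq : q i A (Function.update z j (z' j)) = q i A z := hT i A _ _ fun k hk =>
      Function.update_of_ne (fun h : k = j => hj (h ▸ Finset.mem_of_mem_inter_right hk)) _ _
    have hobs := hP.obsDensity_pos hz y
    have hobsErase := hP.obsDensity_pos (Study.mem_support_erase hz j) y
    have hobsSwap := hP.obsDensity_pos hswap.1 y
    have hknock := hQ.knockoffDensity_pos hS hz hz' y
    have hknockSwap := hQ.knockoffDensity_pos hS hswap.1 hswap.2 y
    simp only [klTerm, hjA, if_true, Model.condDensity, Function.update_eq_self, pairDensity, hq]
    rw [Real.exp_log (by positivity)]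
    field_simp
  · rw [Finset.singleton_inter_of_notMem hjA]
    simp [klTerm, hjA, swapCoord]

theorem lintegral_pairLaw_comp_swapObs (hP : P.Valid) (hQ : Q.Valid)
    (hS : (Q.cop.knockoffCov S).PosDef) (hq : IsMissingness q) {T : Finset (Fin p)}
    (hT : SMAR q T) (B : Finset (Fin p)) {φ : s.PairObs i → ℝ≥0∞} (hφ : Measurable φ) :
    ∫⁻ d, φ (swapObs B d) ∂(pairLaw P Q S q i) = ∑ A, ∑ y, ∫⁻ u,
      ENNReal.ofReal (pairDensity P Q S q A y (swapCoord (B ∩ A) u)) * φ ((A, u.1, y), u.2)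
        ∂((s.obsBase A).prod (s.obsBase A)) := by
  rw [lintegral_pairLaw hP hQ hS hq hT (φ := fun d => φ (swapObs B d))
    (hφ.comp (measurable_swapObs B))]
  refine Finset.sum_congr rfl fun A _ => Finset.sum_congr rfl fun y _ => ?_
  have hpreserve : MeasurePreserving (swapCoord (B ∩ A)) ((s.obsBase A).prod (s.obsBase A))
      ((s.obsBase A).prod (s.obsBase A)) := by
    have h := measurePreserving_swapCoord (B ∩ A) (s.baseAt A) (s.baseAt A)
    simp only [Finset.piecewise_same] at h
    exact h
  have hswapped : Measurable fun u : (Fin p → ℝ) × (Fin p → ℝ) =>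
      ENNReal.ofReal (pairDensity P Q S q A y (swapCoord (B ∩ A) u)) * φ ((A, u.1, y), u.2) :=
    ((measurable_pairDensity P Q S hq A y).comp (measurable_swapCoord _)).ennreal_ofReal.mul
      (hφ.comp (by fun_prop))
  rw [← hpreserve.lintegral_comp hswapped]
  simp only [swapCoord_swapCoord, swapObs_mk]

theorem pairLaw_eq_withDensity (hP : P.Valid) (hQ : Q.Valid) (hS : (Q.cop.knockoffCov S).PosDef)
    (hq : IsMissingness q) {T : Finset (Fin p)} (hT : SMAR q T) {j : Fin p} (hj : j ∉ T) :
    pairLaw P Q S q i = ((pairLaw P Q S q i).map (swapObs {j})).withDensity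
      fun d => ENNReal.ofReal (Real.exp (klTerm P Q S j d)) := by
  have hr : Measurable fun d : s.PairObs i => ENNReal.ofReal (Real.exp (klTerm P Q S j d)) :=
    (measurable_klTerm P Q S j).exp.ennreal_ofReal
  refine Measure.ext_of_lintegral _ fun φ hφ => ?_
  rw [lintegral_withDensity_eq_lintegral_mul _ hr hφ,
    lintegral_map (hr.mul hφ) (measurable_swapObs {j}),
    lintegral_pairLaw_comp_swapObs hP hQ hS hq hT {j} (hr.mul hφ),
    lintegral_pairLaw hP hQ hS hq hT hφ]
  refine Finset.sum_congr rfl fun A _ => Finset.sum_congr rfl fun y _ => lintegral_congr_ae ?_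
  filter_upwards [Measure.quasiMeasurePreserving_fst.ae (s.ae_mem_support A),
    Measure.quasiMeasurePreserving_snd.ae (s.ae_mem_support A)] with u hz hz'
  rw [pairDensity_eq_exp_klTerm_mul hP hQ hS hT hj y hz hz',
    ENNReal.ofReal_mul (Real.exp_pos _).le, Pi.mul_apply]
  ring

theorem pi_pairLaw_eq_withDensity (hP : P.Valid) (hQ : Q.Valid)
    (hS : (Q.cop.knockoffCov S).PosDef) (hq : IsMissingness q) {T : Finset (Fin p)}
    (hT : SMAR q T) {j : Fin p} (hj : j ∉ T) :
    Measure.pi (fun i => pairLaw P Q S q i) =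
      ((Measure.pi fun i => pairLaw P Q S q i).map (swapPair {j})).withDensity
        fun d => ENNReal.ofReal (Real.exp (KLhat P Q S j d)) := by
  have := fun i => isFiniteMeasure_pairLaw (i := i) hP hQ hS hq
  have htilt := fun i => pairLaw_eq_withDensity (i := i) hP hQ hS hq hT hj
  have hσ (i : Fin N) : SigmaFinite (((pairLaw P Q S q i).map (swapObs {j})).withDensity
      fun d => ENNReal.ofReal (Real.exp (klTerm P Q S j d))) := by
    rw [← htilt i]
    infer_instance
  conv_lhs => rw [funext htilt]
  rw [pi_withDensity fun i => (measurable_klTerm P Q S j).exp.ennreal_ofReal,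
    ← Measure.pi_map_pi fun i => (measurable_swapObs {j}).aemeasurable]
  congr 1
  ext1 d
  rw [KLhat_eq_sum, Real.exp_sum, ENNReal.ofReal_prod_of_nonneg fun _ _ => (Real.exp_pos _).le]

theorem pi_pairLaw_inter_KLhat_le (hP : P.Valid) (hQ : Q.Valid)
    (hS : (Q.cop.knockoffCov S).PosDef) (hq : IsMissingness q) {T : Finset (Fin p)}
    (hT : SMAR q T) {j : Fin p} (hj : j ∉ T) (ε : ℝ) {B : Set ((i : Fin N) → s.PairObs i)}
    (hB : MeasurableSet B) :
    Measure.pi (fun i => pairLaw P Q S q i) (B ∩ {d | KLhat P Q S j d ≤ ε}) ≤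
      ENNReal.ofReal (Real.exp ε) *
        Measure.pi (fun i => pairLaw P Q S q i) (swapPair {j} ⁻¹' B) := by
  have hinter : MeasurableSet (B ∩ {d | KLhat P Q S j d ≤ ε}) :=
    hB.inter (measurable_KLhat P Q S j measurableSet_Iic)
  conv_lhs => rw [pi_pairLaw_eq_withDensity hP hQ hS hq hT hj]
  rw [withDensity_apply _ hinter, ← Measure.map_apply (measurable_swapPair _) hB]
  calc _ ≤ ∫⁻ _ in B ∩ {d | KLhat P Q S j d ≤ ε}, ENNReal.ofReal (Real.exp ε)
        ∂((Measure.pi fun i => pairLaw P Q S q i).map (swapPair {j})) :=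
        setLIntegral_mono measurable_const fun d hd =>
          ENNReal.ofReal_le_ofReal (Real.exp_le_exp.2 hd.2)
    _ ≤ _ := by
        rw [setLIntegral_const]
        gcongr
        exact Set.inter_subset_left

end Swap

/-! ### The flip-sign property of the likelihood-based statistics -/

section LikelihoodStatistics

variable {N p J : ℕ} {s : Study N p J}

/-- Exchange the slopes of the predictors in `T` with those of their knockoffs: the parameter of
the extended model that describes the swapped data. -/
def ExtParam.swap (T : Finset (Fin p)) (θ : ExtParam s) : ExtParam s where
  intercept := θ.intercept
  β := T.piecewise θ.γ θ.β
  γ := T.piecewise θ.β θ.γ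
  resVar := θ.resVar

theorem ExtParam.involutive_swap (T : Finset (Fin p)) :
    Function.Involutive (ExtParam.swap T : ExtParam s → ExtParam s) := fun θ => by
  simp [ExtParam.swap, Finset.piecewise_same]

/-- The permutation of the indices of `(t, t')` that exchanges the copies of the indices in `T`,
so that `swapCoord T` becomes a reindexing. -/
def swapIndex (T : Finset (Fin p)) : Fin p ⊕ Fin p → Fin p ⊕ Fin p :=
  Sum.elim (T.piecewise Sum.inr Sum.inl) (T.piecewise Sum.inl Sum.inr)

theorem involutive_swapIndex (T : Finset (Fin p)) : Function.Involutive (swapIndex T) := by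
  rintro (j | j) <;> by_cases hj : j ∈ T <;> simp [swapIndex, hj]

theorem sumElim_swapCoord (T : Finset (Fin p)) (u : (Fin p → ℝ) × (Fin p → ℝ)) :
    Sum.elim (swapCoord T u).1 (swapCoord T u).2 = Sum.elim u.1 u.2 ∘ swapIndex T := by
  ext (j | j) <;> by_cases hj : j ∈ T <;> simp [swapCoord, swapIndex, hj]

theorem Copula.knockoffCov_submatrix_swapIndex (c : Copula p) (S : Fin p → ℝ)
    (T : Finset (Fin p)) :
    (c.knockoffCov S).submatrix (swapIndex T) (swapIndex T) = c.knockoffCov S := by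
  ext (j | j) (k | k) <;> rcases eq_or_ne j k with rfl | hjk <;>
    by_cases hj : j ∈ T <;> try by_cases hk : k ∈ T
  all_goals simp [swapIndex, Copula.knockoffCov, *]

theorem gaussDensity_knockoffCov_swapCoord (c : Copula p) (S : Fin p → ℝ) (T : Finset (Fin p))
    (u : (Fin p → ℝ) × (Fin p → ℝ)) :
    gaussDensity (c.knockoffCov S) (Sum.elim (swapCoord T u).1 (swapCoord T u).2) =
      gaussDensity (c.knockoffCov S) (Sum.elim u.1 u.2) := by
  rw [sumElim_swapCoord]
  exact gaussDensity_comp_equiv ((involutive_swapIndex T).toPerm _)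
    (c.knockoffCov_submatrix_swapIndex S T) _

theorem linPred_swap_add_linPred_swap (T : Finset (Fin p)) (θ : ExtParam s) (c : Copula p)
    (u : (Fin p → ℝ) × (Fin p → ℝ)) :
    s.linPred (θ.swap T).β (c.transVec s (swapCoord T u).1) +
        s.linPred (θ.swap T).γ (c.transVec s (swapCoord T u).2) =
      s.linPred θ.β (c.transVec s u.1) + s.linPred θ.γ (c.transVec s u.2) := by
  simp only [Study.linPred, ← Finset.sum_add_distrib]
  refine Finset.sum_congr rfl fun j _ => Finset.sum_congr rfl fun k _ => ?_
  by_cases hj : j ∈ T <;> simp [ExtParam.swap, swapCoord, Copula.transVec, hj, add_comm]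

theorem Copula.fibreVec_piecewise_inter (c : Copula p) (T A : Finset (Fin p))
    (z z' : Fin p → ℝ) :
    c.fibreVec s A ((T ∩ A).piecewise z' z) = Measure.pi
      (T.piecewise (fun j => c.fibreAt s A j (z' j)) fun j => c.fibreAt s A j (z j)) := by
  rw [Copula.fibreVec_eq_pi]
  congr 1
  ext1 j
  by_cases hT : j ∈ T <;> by_cases hA : j ∈ A <;> simp [Copula.fibreAt, hT, hA]

theorem Copula.measurePreserving_swapCoord_fibreVec (c : Copula p) (T A : Finset (Fin p))
    (z : (Fin p → ℝ) × (Fin p → ℝ)) :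
    MeasurePreserving (swapCoord T) ((c.fibreVec s A z.1).prod (c.fibreVec s A z.2))
      ((c.fibreVec s A (swapCoord (T ∩ A) z).1).prod
        (c.fibreVec s A (swapCoord (T ∩ A) z).2)) := by
  simp only [swapCoord, Copula.fibreVec_piecewise_inter]
  exact measurePreserving_swapCoord T (fun j => c.fibreAt s A j (z.1 j))
    fun j => c.fibreAt s A j (z.2 j)

theorem Copula.extDensity_swap (c : Copula p) (S : Fin p → ℝ) (θ : ExtParam s) {i : Fin N}
    (T A : Finset (Fin p)) (z : (Fin p → ℝ) × (Fin p → ℝ)) (y : s.Resp i) :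
    c.extDensity s S (θ.swap T) A (swapCoord (T ∩ A) z).1 (swapCoord (T ∩ A) z).2 y =
      c.extDensity s S θ A z.1 z.2 y := by
  let e := MeasurableEquiv.ofInvolutive (swapCoord T : (Fin p → ℝ) × (Fin p → ℝ) → _)
    (swapCoord_swapCoord T) (measurable_swapCoord T)
  rw [Copula.extDensity,
    ← (c.measurePreserving_swapCoord_fibreVec T A z).integral_comp e.measurableEmbedding]
  simp only [gaussDensity_knockoffCov_swapCoord, add_assoc, linPred_swap_add_linPred_swap]
  simp only [← add_assoc]
  rfl

variable (c : Copula p) (S : Fin p → ℝ) (d : (i : Fin N) → s.PairObs i)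

theorem Copula.extLogLik_swap (T : Finset (Fin p)) (θ : ExtParam s) :
    c.extLogLik s S (swapPair T d) (θ.swap T) = c.extLogLik s S d θ := by
  refine Finset.sum_congr rfl fun i _ => congrArg Real.log ?_
  rw [← c.extDensity_swap S θ T (d i).1.1 ((d i).1.2.1, (d i).2) (d i).1.2.2, show swapPair T d i =
    _ from swapObs_mk T (d i).1.1 (d i).1.2.2 ((d i).1.2.1, (d i).2)]

theorem Copula.isMLE_swap_iff (T : Finset (Fin p)) (θ : ExtParam s) :
    c.IsMLE s S (swapPair T d) (θ.swap T) ↔ c.IsMLE s S d θ := by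
  refine and_congr Iff.rfl ((ExtParam.involutive_swap T).surjective.forall.trans ?_)
  simp only [c.extLogLik_swap S d T]
  rfl

theorem Copula.existsUnique_isMLE_swapPair_iff (T : Finset (Fin p)) :
    (∃! θ, c.IsMLE s S (swapPair T d) θ) ↔ ∃! θ, c.IsMLE s S d θ :=
  (((ExtParam.involutive_swap T).toPerm _).existsUnique_congr fun {θ} =>
    (c.isMLE_swap_iff S d T θ).symm).symm

theorem Copula.likStat_eq_of_isMLE {θ : ExtParam s} (hθ : c.IsMLE s S d θ)
    (hunique : ∃! θ, c.IsMLE s S d θ) (j : Fin p) :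
    c.likStat s S d j = Real.sign (c.stdNorm s j (θ.β j) - c.stdNorm s j (θ.γ j)) *
      max (c.stdNorm s j (θ.β j) / Real.sqrt (s.kind j).dim)
        (c.stdNorm s j (θ.γ j) / Real.sqrt (s.kind j).dim) := by
  rw [Copula.likStat, dif_pos hunique, hunique.unique hunique.choose_spec.1 hθ]

theorem Copula.likStat_eq_zero (h : ¬ ∃! θ, c.IsMLE s S d θ) (j : Fin p) :
    c.likStat s S d j = 0 := by
  rw [Copula.likStat, dif_neg h]

theorem Copula.flipSign_likStat :
    FlipSign (c.likStat s S : ((i : Fin N) → s.PairObs i) → Fin p → ℝ) := by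
  intro T d j
  have hswap := c.existsUnique_isMLE_swapPair_iff S d T
  by_cases hunique : ∃! θ, c.IsMLE s S d θ
  · obtain ⟨θ, hθ, -⟩ := id hunique
    rw [c.likStat_eq_of_isMLE S _ ((c.isMLE_swap_iff S d T θ).2 hθ) (hswap.2 hunique),
      c.likStat_eq_of_isMLE S d hθ hunique]
    by_cases hj : j ∈ T
    · simp only [ExtParam.swap, hj, if_true, Finset.piecewise_eq_of_mem]
      rw [← neg_sub, Real.sign_neg, max_comm, neg_mul]
    · simp [ExtParam.swap, hj]
  · rw [c.likStat_eq_zero S d hunique, c.likStat_eq_zero S _ (mt hswap.1 hunique), neg_zero,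
      ite_self]

end LikelihoodStatistics

/-! ### The baseline selection -/

section Baseline

variable {N p J : ℕ} {s : Study N p J} {W : Fin p → ℝ} {ν : ℕ}

theorem antitone_negCount (W : Fin p → ℝ) : Antitone (negCount W) := by
  classical
  intro t t' h
  unfold negCount
  gcongr

theorem negCount_eq_one_of_forall_le {t : ℝ} (h : ∀ j, -t ≤ W j) : negCount W t = 1 := by
  rw [negCount, Finset.filter_eq_empty_iff.2 fun j _ => (h j).not_gt, Finset.card_empty]

theorem measurable_negCount (t : ℝ) : Measurable fun W : Fin p → ℝ => negCount W t := by
  simp only [negCount, Finset.card_filter]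
  exact measurable_const.add (Finset.measurable_sum _ fun j _ =>
    Measurable.ite (measurable_pi_apply j measurableSet_Iio) measurable_const measurable_const)

theorem exists_pos_negCount_le (hν : 1 ≤ ν) (W : Fin p → ℝ) :
    {t : ℝ | 0 < t ∧ negCount W t ≤ ν}.Nonempty := by
  refine ⟨1 + ‖W‖, by positivity, (negCount_eq_one_of_forall_le fun j => ?_).trans_le hν⟩
  linarith [neg_abs_le (W j), norm_le_pi_norm W j, Real.norm_eq_abs (W j)]

/-- The strict inequality in `negCount` makes it right-continuous, so that an upper bound passes
to the infimum. -/
theorem negCount_sInf_le (hν : 1 ≤ ν) {A : Set ℝ} (hA : A.Nonempty)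
    (h : ∀ t ∈ A, negCount W t ≤ ν) : negCount W (sInf A) ≤ ν := by
  classical
  by_cases hne : ∃ j, W j < -sInf A
  · obtain ⟨j, hj, hmax⟩ := Finset.exists_max_image (Finset.univ.filter fun j => W j < -sInf A) W
      (by simpa [Finset.filter_nonempty_iff] using hne)
    obtain ⟨t, ht, htj⟩ := exists_lt_of_csInf_lt hA (lt_neg.1 (Finset.mem_filter.1 hj).2)
    refine le_trans ?_ (h t ht)
    unfold negCount
    gcongr 1 + ?_
    refine Finset.card_le_card fun k hk => ?_
    exact Finset.mem_filter.2 ⟨Finset.mem_univ k, (hmax k hk).trans_lt (lt_neg.1 htj)⟩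
  · exact (negCount_eq_one_of_forall_le (by simpa using hne)).trans_le hν

theorem negCount_threshold_le (hν : 1 ≤ ν) (W : Fin p → ℝ) :
    negCount W (threshold ν W) ≤ ν := by
  unfold threshold
  split_ifs with h
  · exact negCount_sInf_le hν h fun t ht => ht.2.le
  · exact negCount_sInf_le hν (exists_pos_negCount_le hν W) fun t ht => ht.2

theorem threshold_nonneg (ν : ℕ) (W : Fin p → ℝ) : 0 ≤ threshold ν W := by
  unfold threshold
  split_ifs <;> exact Real.sInf_nonneg fun t ht => ht.1.le

theorem threshold_le_of_negCount_le {t : ℝ} (ht : 0 < t) (h : negCount W t ≤ ν) :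
    threshold ν W ≤ t := by
  have hbdd (r : ℝ → Prop) : BddBelow {t : ℝ | 0 < t ∧ r t} := ⟨0, fun t ht => ht.1.le⟩
  unfold threshold
  split_ifs with hne
  · rcases h.eq_or_lt with heq | hlt
    · exact csInf_le (hbdd _) ⟨ht, heq⟩
    · obtain ⟨t₀, ht₀⟩ := hne
      have ht₀t : t₀ < t := (antitone_negCount W).reflect_lt (ht₀.2 ▸ hlt)
      exact (csInf_le (hbdd _) ht₀).trans ht₀t.le
  · exact csInf_le (hbdd _) ⟨ht, h⟩

theorem mem_baseline {j : Fin p} : j ∈ baseline ν W ↔ threshold ν W < W j := by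
  simp [baseline]

theorem mem_baseline_iff_exists_rat (hν : 1 ≤ ν) {j : Fin p} :
    j ∈ baseline ν W ↔ ∃ r : ℚ, (0 : ℝ) < r ∧ (r : ℝ) < W j ∧ negCount W r ≤ ν := by
  rw [mem_baseline]
  constructor
  · intro h
    obtain ⟨r, hτr, hrj⟩ := exists_rat_btwn h
    exact ⟨r, (threshold_nonneg ν W).trans_lt hτr, hrj,
      (antitone_negCount W hτr.le).trans (negCount_threshold_le hν W)⟩
  · rintro ⟨r, hr, hrj, hcount⟩
    exact (threshold_le_of_negCount_le hr hcount).trans_lt hrj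

theorem measurableSet_mem_baseline (hν : 1 ≤ ν) (j : Fin p) :
    MeasurableSet {W : Fin p → ℝ | j ∈ baseline ν W} := by
  simp_rw [mem_baseline_iff_exists_rat hν, Set.ofPred_exists]
  exact .iUnion fun r => (MeasurableSet.const _).inter
    ((measurable_pi_apply j measurableSet_Ioi).inter (measurable_negCount r measurableSet_Iic))

/-- The smallest of the thresholds after a sign change, at `j` say, bounds `-W k` from below for
every selected `k`; all of them except `j` are thus counted by `negCount` of that sign change. -/
theorem card_filter_mem_baseline_update_neg_le (hν : 1 ≤ ν) (W : Fin p → ℝ) :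
    (Finset.univ.filter fun j => j ∈ baseline ν (Function.update W j (-W j))).card ≤ ν := by
  set F := Finset.univ.filter fun j => j ∈ baseline ν (Function.update W j (-W j))
  let τ : Fin p → ℝ := fun j => threshold ν (Function.update W j (-W j))
  have hlt : ∀ j ∈ F, W j < -τ j := fun j hj => by
    have := mem_baseline.1 (Finset.mem_filter.1 hj).2
    rw [Function.update_self] at this
    exact lt_neg.1 this
  rcases F.eq_empty_or_nonempty with h | h
  · simp [h]
  · obtain ⟨j, -, hmin⟩ := Finset.exists_min_image F τ h
    have hsub : F ⊆ insert j (open Classical in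
        Finset.univ.filter fun k => Function.update W j (-W j) k < -τ j) := fun k hk => by
      by_cases hkj : k = j
      · exact Finset.mem_insert.2 (.inl hkj)
      · refine Finset.mem_insert_of_mem (Finset.mem_filter.2 ⟨Finset.mem_univ _, ?_⟩)
        rw [Function.update_of_ne hkj]
        linarith [hlt k hk, hmin k hk]
    calc F.card ≤ negCount (Function.update W j (-W j)) (τ j) := by
          rw [negCount, add_comm]
          exact (Finset.card_le_card hsub).trans (Finset.card_insert_le _ _)
      _ ≤ ν := negCount_threshold_le hν _

theorem FlipSign.swapPair_singleton {w : ((i : Fin N) → s.PairObs i) → Fin p → ℝ}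
    (hw : FlipSign w) (d : (i : Fin N) → s.PairObs i) (j : Fin p) :
    w (swapPair {j} d) = Function.update (w d) j (-w d j) := by
  ext k
  rw [hw]
  rcases eq_or_ne k j with rfl | hkj <;> simp [*]

end Baseline

/-! ### Cardinalities of random sets and non-increasing laws -/

section RandomCard

variable {Ω ι : Type*} [MeasurableSpace Ω] {μ : Measure Ω} {F : Ω → Finset ι}

theorem aemeasurable_card [Finite ι] (hF : ∀ j, NullMeasurableSet {ω | j ∈ F ω} μ) :
    AEMeasurable (fun ω => (F ω).card) μ := by
  classical
  have := Fintype.ofFinite ι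
  have hsum (ω : Ω) : (F ω).card = ∑ j, {ω | j ∈ F ω}.indicator (fun _ => 1) ω := by
    simp [Set.indicator_apply]
  simp only [hsum]
  exact Finset.aemeasurable_fun_sum _ fun j _ => aemeasurable_const.indicator₀ (hF j)

theorem integrable_card [Finite ι] [IsFiniteMeasure μ]
    (hF : ∀ j, NullMeasurableSet {ω | j ∈ F ω} μ) :
    Integrable (fun ω => ((F ω).card : ℝ)) μ := by
  have := Fintype.ofFinite ι
  exact .of_bound
    (measurable_from_top.comp_aemeasurable (aemeasurable_card hF)).aestronglyMeasurable
    (Fintype.card ι) (ae_of_all _ fun ω => by simpa using Finset.card_le_univ (F ω))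

theorem integral_card [Fintype ι] [IsFiniteMeasure μ]
    (hF : ∀ j, NullMeasurableSet {ω | j ∈ F ω} μ) :
    ∫ ω, ((F ω).card : ℝ) ∂μ = ∑ j, μ.real {ω | j ∈ F ω} := by
  classical
  have hsum (ω : Ω) : ((F ω).card : ℝ) = ∑ j, {ω | j ∈ F ω}.indicator (fun _ => (1 : ℝ)) ω := by
    simp [Set.indicator_apply]
  simp only [hsum]
  rw [integral_finsetSum _ fun j _ => (integrable_const (1 : ℝ)).indicator₀ (hF j)]
  simp only [integral_indicator₀ (hF _), setIntegral_const, smul_eq_mul, mul_one]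

end RandomCard

section Antitone

/-- Since `k ≥ h` is reflected to `M - k < h` with a larger weight, the missing mass
`∑ k ≥ h, (M - k) * a k` is at most `∑ k < h, k * a k`. -/
theorem mul_sum_Ico_le_sum_mul_of_antitoneOn {a : ℕ → ℝ} {M h : ℕ} (ha : ∀ k, 0 ≤ a k)
    (hanti : AntitoneOn a (Set.Iic M)) (hh : M + 1 ≤ 2 * h) :
    M * ∑ k ∈ Finset.Ico h (M + 1), a k ≤ ∑ k ∈ Finset.range (M + 1), k * a k := by
  have hdisj : Disjoint (Finset.Ico h (M + 1)) (Finset.Ico 0 (M + 1 - h)) :=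
    Finset.disjoint_left.2 fun k hk hk' => by
      simp only [Finset.mem_Ico] at hk hk'
      omega
  calc M * ∑ k ∈ Finset.Ico h (M + 1), a k
      = ∑ k ∈ Finset.Ico h (M + 1), (k * a k + (M - k : ℕ) * a k) := by
        rw [Finset.mul_sum]
        refine Finset.sum_congr rfl fun k hk => ?_
        rw [Nat.cast_sub (Nat.le_of_lt_succ (Finset.mem_Ico.1 hk).2)]
        ring
    _ ≤ ∑ k ∈ Finset.Ico h (M + 1), (k * a k + (M - k : ℕ) * a (M - k)) := by
        gcongr with k hk
        rw [Finset.mem_Ico] at hk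
        exact hanti (Set.mem_Iic.2 (by omega)) (Set.mem_Iic.2 (by omega)) (by omega)
    _ = ∑ k ∈ Finset.Ico h (M + 1) ∪ Finset.Ico 0 (M + 1 - h), k * a k := by
        rw [Finset.sum_add_distrib, Finset.sum_Ico_reflect (fun k => (k : ℝ) * a k) h le_rfl,
          Nat.sub_self, Finset.sum_union hdisj]
    _ ≤ ∑ k ∈ Finset.range (M + 1), k * a k := by
        refine Finset.sum_le_sum_of_subset_of_nonneg (fun k hk => ?_)
          fun k _ _ => mul_nonneg k.cast_nonneg (ha k)
        simp only [Finset.mem_union, Finset.mem_Ico, Finset.mem_range] at hk ⊢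
        omega

variable {Ω : Type*} [MeasurableSpace Ω] {μ : Measure Ω} [IsFiniteMeasure μ]

theorem mul_measureReal_le_integral_of_antitoneOn {n : Ω → ℕ} {M h : ℕ} (hn : AEMeasurable n μ)
    (hnM : ∀ ω, n ω ≤ M) (hanti : AntitoneOn (fun k => μ.real {ω | n ω = k}) (Set.Iic M))
    (hh : M + 1 ≤ 2 * h) : M * μ.real {ω | h ≤ n ω} ≤ ∫ ω, (n ω : ℝ) ∂μ := by
  have hmap (B : Set ℕ) : (μ.map n).real B = μ.real (n ⁻¹' B) :=
    map_measureReal_apply_of_aemeasurable hn .of_discrete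
  have htail : μ.real {ω | h ≤ n ω} =
      ∑ k ∈ Finset.Ico h (M + 1), μ.real {ω | n ω = k} := by
    refine Eq.trans ?_ ((hmap (Finset.Ico h (M + 1))).symm.trans
      ((sum_measureReal_singleton _).symm.trans (Finset.sum_congr rfl fun k _ => hmap {k})))
    congr 1
    ext ω
    simp [Nat.lt_succ_of_le (hnM ω)]
  have hmean : ∫ ω, (n ω : ℝ) ∂μ =
      ∑ k ∈ Finset.range (M + 1), k * μ.real {ω | n ω = k} := by
    have hmem : ∀ᵐ k ∂(μ.map n), k ∈ (Finset.range (M + 1) : Set ℕ) :=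
      (ae_map_iff hn .of_discrete).2 (ae_of_all _ fun ω => by simp [Nat.lt_succ_of_le (hnM ω)])
    rw [← integral_map hn (f := fun k : ℕ => (k : ℝ))
      measurable_from_top.aestronglyMeasurable, ← Measure.restrict_eq_self_of_ae_mem hmem,
      setIntegral_finset _ .finset]
    exact Finset.sum_congr rfl fun k _ => by rw [hmap, smul_eq_mul, mul_comm]; rfl
  rw [htail, hmean]
  exact mul_sum_Ico_le_sum_mul_of_antitoneOn (fun _ => measureReal_nonneg) hanti hh

end Antitone

/-! ### Control of the expected number of false selections -/

section Control

variable {N p J M : ℕ} {s : Study N p J} {P Q : Model s} {S : Fin p → ℝ}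
  {q : Fin N → Finset (Fin p) → (Fin p → ℝ) → ℝ} {w : ((i : Fin N) → s.PairObs i) → Fin p → ℝ}
  {ν : ℕ} {ε : ℝ}

theorem sum_measure_preimage_swapPair_le (hwm : Measurable w) (hw : FlipSign w) (hν : 1 ≤ ν)
    (L : Measure ((i : Fin N) → s.PairObs i)) :
    ∑ j, L (swapPair {j} ⁻¹' {d | j ∈ baseline ν (w d)}) ≤ ν * L Set.univ := by
  have hmeas (j : Fin p) : MeasurableSet (swapPair {j} ⁻¹' {d | j ∈ baseline ν (w d)}) :=
    measurable_swapPair {j} (hwm (measurableSet_mem_baseline hν j))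
  calc ∑ j, L (swapPair {j} ⁻¹' {d | j ∈ baseline ν (w d)})
      = ∫⁻ d, ∑ j, (swapPair {j} ⁻¹' {d | j ∈ baseline ν (w d)}).indicator 1 d ∂L := by
        rw [lintegral_finsetSum _ fun j _ => measurable_one.indicator (hmeas j)]
        simp only [lintegral_indicator_one (hmeas _)]
    _ = ∫⁻ d, (Finset.univ.filter fun j =>
          j ∈ baseline ν (Function.update (w d) j (-w d j))).card ∂L := by
        simp [Set.indicator_apply, hw.swapPair_singleton]
    _ ≤ ∫⁻ _, ν ∂L := by
        gcongr with d
        exact card_filter_mem_baseline_update_neg_le hν (w d)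
    _ = ν * L Set.univ := lintegral_const _

/-- The data of a single run for which `j` is selected with observed divergence at most `ε`. -/
def selEvent (P Q : Model s) (S : Fin p → ℝ) (w : ((i : Fin N) → s.PairObs i) → Fin p → ℝ)
    (ν : ℕ) (ε : ℝ) (j : Fin p) : Set ((i : Fin N) → s.PairObs i) :=
  {d | j ∈ baseline ν (w d)} ∩ {d | KLhat P Q S j d ≤ ε}

theorem measurableSet_selEvent (P Q : Model s) (S : Fin p → ℝ) (hwm : Measurable w)
    (hν : 1 ≤ ν) (ε : ℝ) (j : Fin p) : MeasurableSet (selEvent P Q S w ν ε j) :=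
  (hwm (measurableSet_mem_baseline hν j)).inter (measurable_KLhat P Q S j measurableSet_Iic)

theorem sum_pi_pairLaw_selEvent_le (hP : P.Valid) (hQ : Q.Valid)
    (hS : (Q.cop.knockoffCov S).PosDef) (hq : IsMissingness q) {T : Finset (Fin p)}
    (hT : SMAR q T) (hwm : Measurable w) (hw : FlipSign w) (hν : 1 ≤ ν) (ε : ℝ) :
    ∑ j ∈ Tᶜ, Measure.pi (fun i => pairLaw P Q S q i) (selEvent P Q S w ν ε j) ≤
      ENNReal.ofReal (Real.exp ε) *
        (ν * Measure.pi (fun i => pairLaw P Q S q i) Set.univ) :=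
  calc _ ≤ ∑ j ∈ Tᶜ, ENNReal.ofReal (Real.exp ε) * Measure.pi (fun i => pairLaw P Q S q i)
        (swapPair {j} ⁻¹' {d | j ∈ baseline ν (w d)}) :=
        Finset.sum_le_sum fun j hj => pi_pairLaw_inter_KLhat_le hP hQ hS hq hT
          (Finset.mem_compl.1 hj) ε (hwm (measurableSet_mem_baseline hν j))
    _ ≤ ∑ j, ENNReal.ofReal (Real.exp ε) * Measure.pi (fun i => pairLaw P Q S q i)
        (swapPair {j} ⁻¹' {d | j ∈ baseline ν (w d)}) :=
        Finset.sum_le_univ_sum_of_nonneg fun _ => zero_le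
    _ ≤ _ := by
        rw [← Finset.mul_sum]
        gcongr
        exact sum_measure_preimage_swapPair_le hwm hw hν _

variable {Ω : Type*} {X : (i : Fin N) → Ω → s.Obs i} {Z : Fin M → Fin N → Ω → Fin p → ℝ}

/-- The runs counted by `PiDagger`. -/
def passingRuns (P Q : Model s) (S : Fin p → ℝ) (w : ((i : Fin N) → s.PairObs i) → Fin p → ℝ)
    (ν : ℕ) (ε : ℝ) (X : (i : Fin N) → Ω → s.Obs i) (Z : Fin M → Fin N → Ω → Fin p → ℝ)
    (j : Fin p) (ω : Ω) : Finset (Fin M) :=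
  open Classical in Finset.univ.filter fun m => runData X Z m ω ∈ selEvent P Q S w ν ε j

theorem PiDagger_eq_card_div (j : Fin p) (ω : Ω) :
    PiDagger P Q S w ν ε X Z j ω = (passingRuns P Q S w ν ε X Z j ω).card / M := by
  rw [PiDagger, passingRuns, Finset.natCast_card_filter]
  congr!

theorem setOf_mem_passingRuns (j : Fin p) (m : Fin M) :
    {ω | m ∈ passingRuns P Q S w ν ε X Z j ω} =
      runData X Z m ⁻¹' selEvent P Q S w ν ε j := by
  ext ω
  simp [passingRuns]

theorem mem_selectedNulls_iff {η : ℝ} {ω : Ω} {j : Fin p} :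
    j ∈ selectedNulls P Q S w ν η ε X Z ω ↔ j ∉ P.nonnull ∧
      η ≤ PiDagger P Q S w ν ε X Z j ω ∧ ∀ m, KLhat P Q S j (runData X Z m ω) ≤ ε := by
  have hfreq (h : ∀ m, KLhat P Q S j (runData X Z m ω) ≤ ε) :
      frequency (runSel w ν X Z ω) j = PiDagger P Q S w ν ε X Z j ω := by
    simp only [frequency, PiDagger, h, and_true]
  simp only [selectedNulls, derandomised, Finset.mem_filter, Finset.mem_sdiff, Finset.mem_univ,
    true_and]
  constructor
  · rintro ⟨⟨hη, hj⟩, hKL⟩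
    exact ⟨hj, hfreq hKL ▸ hη, hKL⟩
  · rintro ⟨hj, hη, hKL⟩
    exact ⟨⟨(hfreq hKL).symm ▸ hη, hj⟩, hKL⟩

variable [MeasurableSpace Ω] {μ : Measure Ω}

theorem hasLaw_runData (hP : P.Valid) (hQ : Q.Valid) (hS : (Q.cop.knockoffCov S).PosDef)
    (hq : IsMissingness q)
    (hlaw : HasLaw (fun ω i => (X i ω, fun m => Z m i ω)) (studyLaw P Q S q M) μ) (m : Fin M) :
    HasLaw (runData X Z m) (Measure.pi fun i => pairLaw P Q S q i) μ :=
  have hproj : HasLaw (fun (d : (i : Fin N) → s.Obs i × (Fin M → Fin p → ℝ)) i =>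
      (((d i).1, (d i).2 m) : s.PairObs i)) (Measure.pi fun i => pairLaw P Q S q i)
      (studyLaw P Q S q M) :=
    ⟨Measurable.aemeasurable (by fun_prop), map_studyLaw hP hQ hS hq m⟩
  hproj.comp hlaw

theorem sum_measureReal_selEvent_le [IsProbabilityMeasure μ] (hP : P.Valid) (hQ : Q.Valid)
    (hS : (Q.cop.knockoffCov S).PosDef) (hq : IsMissingness q) {T : Finset (Fin p)}
    (hT : SMAR q T) (hwm : Measurable w) (hw : FlipSign w) (hν : 1 ≤ ν)
    (hlaw : HasLaw (fun ω i => (X i ω, fun m => Z m i ω)) (studyLaw P Q S q M) μ) (m : Fin M) :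
    ∑ j ∈ Tᶜ, μ.real (runData X Z m ⁻¹' selEvent P Q S w ν ε j) ≤ ν * Real.exp ε := by
  have hrun := hasLaw_runData hP hQ hS hq hlaw m
  have hprob : IsProbabilityMeasure (Measure.pi fun i => pairLaw P Q S q i) :=
    hrun.isProbabilityMeasure_iff.1 inferInstance
  have hle := sum_pi_pairLaw_selEvent_le hP hQ hS hq hT hwm hw hν ε
  rw [measure_univ, mul_one] at hle
  have hreal := ENNReal.toReal_mono (by finiteness) hle
  rw [ENNReal.toReal_sum fun j _ => measure_ne_top _ _, ENNReal.toReal_mul,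
    ENNReal.toReal_natCast, ENNReal.toReal_ofReal (Real.exp_pos ε).le, mul_comm] at hreal
  refine le_of_eq_of_le (Finset.sum_congr rfl fun j _ => ?_) hreal
  exact hrun.measureReal_eq (measurableSet_selEvent P Q S hwm hν ε j)

theorem nullMeasurableSet_mem_passingRuns (hwm : Measurable w) (hν : 1 ≤ ν)
    (hrun : ∀ m, AEMeasurable (runData X Z m) μ) (j : Fin p) (m : Fin M) :
    NullMeasurableSet {ω | m ∈ passingRuns P Q S w ν ε X Z j ω} μ := by
  rw [setOf_mem_passingRuns]
  exact (hrun m).nullMeasurable (measurableSet_selEvent P Q S hwm hν ε j)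

theorem nullMeasurableSet_mem_selectedNulls (hwm : Measurable w) (hν : 1 ≤ ν)
    (hrun : ∀ m, AEMeasurable (runData X Z m) μ) (η : ℝ) (j : Fin p) :
    NullMeasurableSet {ω | j ∈ selectedNulls P Q S w ν η ε X Z ω} μ := by
  have hcard : AEMeasurable (fun ω => (passingRuns P Q S w ν ε X Z j ω).card) μ :=
    aemeasurable_card (nullMeasurableSet_mem_passingRuns hwm hν hrun j)
  have hdiv : Measurable fun n : ℕ => (n : ℝ) / M := measurable_from_top
  have hη : NullMeasurableSet {ω | η ≤ PiDagger P Q S w ν ε X Z j ω} μ := by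
    simp only [PiDagger_eq_card_div]
    exact (hdiv.comp_aemeasurable hcard).nullMeasurable measurableSet_Ici
  have hset : {ω | j ∈ selectedNulls P Q S w ν η ε X Z ω} =
      {_ω | j ∉ P.nonnull} ∩ ({ω | η ≤ PiDagger P Q S w ν ε X Z j ω} ∩
        ⋂ m, runData X Z m ⁻¹' (KLhat P Q S j ⁻¹' Set.Iic ε)) := by
    ext ω
    simp [mem_selectedNulls_iff]
  rw [hset]
  exact (MeasurableSet.const _).nullMeasurableSet.inter (hη.inter (.iInter fun m =>
    (hrun m).nullMeasurable (measurable_KLhat P Q S j measurableSet_Iic)))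

variable [IsFiniteMeasure μ]

theorem integral_PiDagger (hwm : Measurable w) (hν : 1 ≤ ν)
    (hrun : ∀ m, AEMeasurable (runData X Z m) μ) (j : Fin p) :
    ∫ ω, PiDagger P Q S w ν ε X Z j ω ∂μ =
      (∑ m, μ.real (runData X Z m ⁻¹' selEvent P Q S w ν ε j)) / M := by
  simp only [PiDagger_eq_card_div]
  rw [integral_div, integral_card (nullMeasurableSet_mem_passingRuns hwm hν hrun j)]
  simp only [setOf_mem_passingRuns]

theorem integral_card_selectedNulls_le (hwm : Measurable w) (hν : 1 ≤ ν)
    (hrun : ∀ m, AEMeasurable (runData X Z m) μ) {η : ℝ}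
    (hη : ∀ j, j ∉ P.nonnull →
      μ.real {ω | η ≤ PiDagger P Q S w ν ε X Z j ω} ≤ ∫ ω, PiDagger P Q S w ν ε X Z j ω ∂μ) :
    ∫ ω, ((selectedNulls P Q S w ν η ε X Z ω).card : ℝ) ∂μ ≤
      (∑ m, ∑ j ∈ P.nonnullᶜ, μ.real (runData X Z m ⁻¹' selEvent P Q S w ν ε j)) / M := by
  have hzero (j) (hj : j ∉ P.nonnullᶜ) :
      μ.real {ω | j ∈ selectedNulls P Q S w ν η ε X Z ω} = 0 := by
    simp [mem_selectedNulls_iff, Finset.notMem_compl.1 hj]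
  rw [integral_card (nullMeasurableSet_mem_selectedNulls hwm hν hrun η),
    ← Finset.sum_subset (Finset.subset_univ P.nonnullᶜ) fun j _ => hzero j, Finset.sum_comm,
    Finset.sum_div]
  refine Finset.sum_le_sum fun j hj => ?_
  calc μ.real {ω | j ∈ selectedNulls P Q S w ν η ε X Z ω}
      ≤ μ.real {ω | η ≤ PiDagger P Q S w ν ε X Z j ω} :=
        measureReal_mono fun ω hω => (mem_selectedNulls_iff.1 hω).2.1
    _ ≤ ∫ ω, PiDagger P Q S w ν ε X Z j ω ∂μ := hη j (Finset.mem_compl.1 hj)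
    _ = _ := integral_PiDagger hwm hν hrun j

theorem measureReal_le_integral_PiDagger_of_antitone (hwm : Measurable w) (hν : 1 ≤ ν)
    (hrun : ∀ m, AEMeasurable (runData X Z m) μ) {η : ℝ}
    (hM : M + 1 ≤ 2 * ⌈η * M⌉₊) {j : Fin p} (hanti : ∀ k l : ℕ, k ≤ l → l ≤ M →
      μ.real {ω | PiDagger P Q S w ν ε X Z j ω = (l : ℝ) / M} ≤
        μ.real {ω | PiDagger P Q S w ν ε X Z j ω = (k : ℝ) / M}) :
    μ.real {ω | η ≤ PiDagger P Q S w ν ε X Z j ω} ≤ ∫ ω, PiDagger P Q S w ν ε X Z j ω ∂μ := by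
  have hM0 : (0 : ℝ) < M := by
    rcases M.eq_zero_or_pos with rfl | h
    · simp at hM
    · exact_mod_cast h
  simp only [PiDagger_eq_card_div, div_left_inj' hM0.ne', Nat.cast_inj] at hanti
  simp only [PiDagger_eq_card_div, le_div_iff₀ hM0, ← Nat.ceil_le]
  rw [integral_div, le_div_iff₀' hM0]
  exact mul_measureReal_le_integral_of_antitoneOn
    (aemeasurable_card (nullMeasurableSet_mem_passingRuns hwm hν hrun j))
    (fun ω => (Finset.card_le_univ _).trans_eq (Fintype.card_fin M))
    (fun k _ l hl hkl => hanti k l hkl hl) hM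

end Control

end LatentKnockoff

end

theorem theorem2_general {N p J M : ℕ} (s : Study N p J)
    (P Q : Model s) (hP : P.Valid) (hQ : Q.Valid)
    (S : Fin p → ℝ) (hS : (Q.cop.knockoffCov S).PosDef)
    (q : Fin N → Finset (Fin p) → (Fin p → ℝ) → ℝ) (hq : IsMissingness q)
    (hSMAR : SMAR q P.nonnull)
    (w : ((i : Fin N) → s.PairObs i) → Fin p → ℝ) (hwm : Measurable w)
    (hw : FlipSign w)
    {Ω : Type*} [MeasurableSpace Ω] (μ : Measure Ω) [IsProbabilityMeasure μ]
    (X : (i : Fin N) → Ω → s.Obs i) (Z : Fin M → Fin N → Ω → Fin p → ℝ)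
    (hlaw : HasLaw (fun ω i => (X i ω, fun m => Z m i ω)) (studyLaw P Q S q M) μ)
    (ν : ℕ) (hν : 1 ≤ ν) (ε : ℝ) :
    (∀ η : ℝ,
      (∀ j, j ∉ P.nonnull →
        μ.real {ω | η ≤ PiDagger P Q S w ν ε X Z j ω} ≤ ∫ ω, PiDagger P Q S w ν ε X Z j ω ∂μ) →
      Integrable (fun ω => ((selectedNulls P Q S w ν η ε X Z ω).card : ℝ)) μ ∧
        ∫ ω, ((selectedNulls P Q S w ν η ε X Z ω).card : ℝ) ∂μ ≤ ν * Real.exp ε) ∧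
    (∀ η : ℝ, M + 1 ≤ 2 * ⌈η * M⌉₊ → ∀ j,
      (∀ k l : ℕ, k ≤ l → l ≤ M →
        μ.real {ω | PiDagger P Q S w ν ε X Z j ω = (l : ℝ) / M} ≤
          μ.real {ω | PiDagger P Q S w ν ε X Z j ω = (k : ℝ) / M}) →
      μ.real {ω | η ≤ PiDagger P Q S w ν ε X Z j ω} ≤
        ∫ ω, PiDagger P Q S w ν ε X Z j ω ∂μ) := by
  have hrun (m : Fin M) : AEMeasurable (runData X Z m) μ :=
    (hasLaw_runData hP hQ hS hq hlaw m).aemeasurable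
  refine ⟨fun η hη => ⟨integrable_card (nullMeasurableSet_mem_selectedNulls hwm hν hrun η), ?_⟩,
    fun η hM j hanti => measureReal_le_integral_PiDagger_of_antitone hwm hν hrun hM hanti⟩
  refine (integral_card_selectedNulls_le hwm hν hrun hη).trans
    (div_le_of_le_mul₀ M.cast_nonneg (by positivity) ?_)
  rw [mul_comm, ← nsmul_eq_mul]
  simpa using Finset.sum_le_card_nsmul Finset.univ _ _ fun m _ =>
    sum_measureReal_selEvent_le hP hQ hS hq hSMAR hwm hw hν (ε := ε) hlaw m

theorem theorem2 {N p J M : ℕ} (s : Study N p J)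
    (P Q : Model s) (hP : P.Valid) (hQ : Q.Valid)
    (S : Fin p → ℝ) (hS : (Q.cop.knockoffCov S).PosDef)
    (q : Fin N → Finset (Fin p) → (Fin p → ℝ) → ℝ) (hq : IsMissingness q)
    (hSMAR : SMAR q P.nonnull)
    (w : ((i : Fin N) → s.PairObs i) → Fin p → ℝ) (hwm : Measurable w)
    (hw : w = Q.cop.likStat s S ∨ FlipSign w)
    {Ω : Type*} [MeasurableSpace Ω] (μ : Measure Ω) [IsProbabilityMeasure μ]
    (X : (i : Fin N) → Ω → s.Obs i) (Z : Fin M → Fin N → Ω → Fin p → ℝ)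
    (hlaw : HasLaw (fun ω i => (X i ω, fun m => Z m i ω)) (studyLaw P Q S q M) μ)
    (ν : ℕ) (hν : 1 ≤ ν) (ε : ℝ) (hε : 0 ≤ ε) :
    (∀ η : ℝ,
      (∀ j, j ∉ P.nonnull →
        μ.real {ω | η ≤ PiDagger P Q S w ν ε X Z j ω} ≤ ∫ ω, PiDagger P Q S w ν ε X Z j ω ∂μ) →
      Integrable (fun ω => ((selectedNulls P Q S w ν η ε X Z ω).card : ℝ)) μ ∧
        ∫ ω, ((selectedNulls P Q S w ν η ε X Z ω).card : ℝ) ∂μ ≤ ν * Real.exp ε) ∧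
    (M = 31 → ∀ j, j ∉ P.nonnull →
      (∀ k l : ℕ, k ≤ l → l ≤ M →
        μ.real {ω | PiDagger P Q S w ν ε X Z j ω = (l : ℝ) / M} ≤
          μ.real {ω | PiDagger P Q S w ν ε X Z j ω = (k : ℝ) / M}) →
      μ.real {ω | (1 / 2 : ℝ) ≤ PiDagger P Q S w ν ε X Z j ω} ≤
        ∫ ω, PiDagger P Q S w ν ε X Z j ω ∂μ) := by
  have h := theorem2_general s P Q hP hQ S hS q hq hSMAR w hwm
    (hw.elim (· ▸ Q.cop.flipSign_likStat S) id) μ X Z hlaw ν hν ε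
  exact ⟨h.1, by rintro rfl j -; exact h.2 (1 / 2) (by norm_num) j⟩
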